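/- Let $\Gamma$ be a countable group, let $n\ge 2$, let $\Sigma,\Gamma_1,\dots,\Gamma_n\leqslant\Gamma$ be subgroups, and let $I\sqcup J=\{1,\dots,n\}$ be a partition with $|I|\ge 2$. For a subgroup $\Lambda\leqslant\Gamma$ let $\mathcal L(\Lambda)\subseteq\mathcal L(\Gamma)=:\mathcal M\subseteq B(\ell^2\Gamma)$ be the von Neumann algebra generated by the left translations $u_g$, $g\in\Lambda$, and let $\tau(x)=\langle x\delta_1,\delta_1\rangle$ be the canonical trace. We say that $\Sigma$ is \emph{$I$-$J$-fixable} with respect to $(\Gamma_1,\dots,\Gamma_n)$ if for all finite sets $F_i,K_i\subset\Gamma$ ($1\le i\le n$) there exist finite sets $G_j\subset F_j\Gamma_jK_j$ ($j\in J$) and, for each $i\in I$, finitely many injective maps $\sigma_i^1,\dots,\sigma_i^{l_i}:\Sigma\setminus\{1\}\to\Gamma$ such that, whenever $g\in\Sigma\setminus\{1\}$ and $g_i\in F_i\Gamma_iK_i\setminus\{1\}$ ($1\le i\le n$) satisfy $g_j\notin G_j$ for all $j\in J$ and $g\,g_1g_2\cdots g_n=1$, then for every $i\in I$ one has $g_i=\sigma_i^k(g)$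 for some $1\le k\le l_i$. For von Neumann subalgebras $\mathcal P,\mathcal Q\subseteq\mathcal M$ and a projection $p\in\mathcal P'\cap\mathcal M$, write $\mathcal Pp\prec_{\mathcal M}\mathcal Q$ if there are finitely many $x_i,y_i\in\mathcal M$ and $C>0$ with $\sum_i\|E_{\mathcal Q}(x_iuy_i)\|_2^2\ge C$ for every unitary $u$ of $\mathcal Pp$, where $E_{\mathcal Q}$ is the $\tau$-preserving conditional expectation onto $\mathcal Q$; and write $\mathcal P\prec^s_{\mathcal M}\mathcal Q$ if $\mathcal Pp\prec_{\mathcal M}\mathcal Q$ for every nonzero projection $p\in\mathcal P'\cap\mathcal M$. \textbf{Theorem.} Assume that $\Sigma$ is $I$-$J$-fixable with respect to $(\Gamma_1,\dots,\Gamma_n)$. Let $\mathcal M_1,\dots,\mathcal M_n\subseteq\mathcal M$ be (unital) von Neumann subalgebras such that $\mathcal M_i\prec^s_{\mathcal M}\mathcal L(\Gamma_i)$ for all $1\le i\le n$. For every $j\in J$ let $(x^j_k)_{k\in\mathbb N}$ be a sequence in the unit ball $(\mathcal M_j)_1$ with $x^j_k\to0$ in the weak operator topology as $k\to\infty$. Let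 $\mathscr G\subseteq\mathscr U(\mathcal L(\Sigma))$ be a set such that for every $x\in\mathscr G$ there exist unitaries $x_i\in\mathscr U(\mathcal M_i)$ ($i\in I$) such that for all $k\in\mathbb N$ $$x\,a^1_ka^2_k\cdots a^n_k=1,\qquad\text{where } a^i_k=x_i \text{ if } i\in I \text{ and } a^j_k=x^j_k\text{ if } j\in J.$$ Then the height $$h_\Sigma(\mathscr G)=\inf_{x\in\mathscr G}\ \sup_{\gamma\in\Sigma}|\tau(xu_\gamma^*)|$$ is strictly positive (with the convention $\inf\emptyset=+\infty$). -/

import Mathlib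

open Filter Topology
open scoped Pointwise ENNReal

noncomputable section

/-- The Hilbert space `ℓ²(G)`. -/
abbrev EllTwo (G : Type*) : Type _ := lp (fun _ : G => ℂ) 2

/-- Bounded operators on `ℓ²(G)`. -/
abbrev EllTwoOp (G : Type*) : Type _ := EllTwo G →L[ℂ] EllTwo G

open Classical in
/-- The Dirac function `δ_g ∈ ℓ²(G)`. -/
def dirac {G : Type*} (g : G) : EllTwo G := lp.single 2 g (1 : ℂ)

/-- The isometry `u_g` of the left regular representation: `(u_g ξ)(h) = ξ (g⁻¹ h)`. -/
def leftRegularIsometry {G : Type*} [Group G] (g : G) : EllTwo G →ₗᵢ[ℂ] EllTwo G where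
  toFun ξ := ⟨fun h => ξ (g⁻¹ * h), by
    have hξ := (memℓp_gen_iff (by norm_num)).mp (lp.memℓp ξ)
    exact (memℓp_gen_iff (by norm_num)).mpr ((Equiv.mulLeft g⁻¹).summable_iff.mpr hξ)⟩
  map_add' ξ η := by ext h; rfl
  map_smul' c ξ := by ext h; rfl
  norm_map' ξ := by
    rw [lp.norm_eq_tsum_rpow (by norm_num), lp.norm_eq_tsum_rpow (by norm_num)]
    congr 1
    exact (Equiv.mulLeft g⁻¹).tsum_eq (fun h => ‖ξ h‖ ^ (2 : ℝ≥0∞).toReal)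

/-- The canonical operators `u_g ∈ B(ℓ²(G))` of the left regular representation. -/
def leftRegular {G : Type*} [Group G] (g : G) : EllTwoOp G :=
  (leftRegularIsometry g).toContinuousLinearMap

theorem leftRegular_apply {G : Type*} [Group G] (g h : G) (ξ : EllTwo G) :
    leftRegular g ξ h = ξ (g⁻¹ * h) := rfl

theorem leftRegular_dirac {G : Type*} [Group G] (g h : G) :
    leftRegular g (dirac h) = dirac (g * h) := by
  ext k
  rw [leftRegular_apply]
  have hk : g⁻¹ * k = h ↔ k = g * h := inv_mul_eq_iff_eq_mul
  by_cases hc : k = g * h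
  · simp [dirac, hc]
  · simp [dirac, hk, hc]

/-- The von Neumann algebra on `H` generated by a set `S` of bounded operators: the bicommutant of
`S ∪ S*`. -/
def vonNeumannGenerated {H : Type*} [NormedAddCommGroup H] [InnerProductSpace ℂ H]
    [CompleteSpace H] (S : Set (H →L[ℂ] H)) : VonNeumannAlgebra H where
  toStarSubalgebra :=
    StarSubalgebra.centralizer ℂ (StarSubalgebra.centralizer ℂ S : Set (H →L[ℂ] H))
  centralizer_centralizer' := by simp

/-- For a subgroup `Λ ≤ G`, the von Neumann algebra `L(Λ)`, realised inside `L(G) ⊆ B(ℓ²(G))` as the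
von Neumann algebra generated by `{u_g : g ∈ Λ}`. -/
def groupVN {G : Type*} [Group G] (Λ : Subgroup G) : VonNeumannAlgebra (EllTwo G) :=
  vonNeumannGenerated (leftRegular '' (Λ : Set G))

/-- The canonical trace `τ(x) = ⟨x δ_1, δ_1⟩` on `L(G)`. -/
def groupTrace {G : Type*} [Group G] (x : EllTwoOp G) : ℂ :=
  inner ℂ (dirac (1 : G)) (x (dirac 1))

/-- `h_Λ(x) = sup_{γ ∈ Λ} |τ(x u_γ*)|`, the largest modulus of a Fourier coefficient
of `x ∈ L(Λ)`. -/
def elementHeight {G : Type*} [Group G] (Λ : Subgroup G) (x : EllTwoOp G) : ℝ≥0∞ :=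
  ⨆ γ : Λ, ‖groupTrace (x * star (leftRegular (γ : G)))‖ₑ

/-- The height `h_Λ(𝒢) = inf_{x ∈ 𝒢} h_Λ(x)` of a set `𝒢 ⊆ L(Λ)`
(with the convention `inf ∅ = ∞`). -/
def height {G : Type*} [Group G] (Λ : Subgroup G) (𝒢 : Set (EllTwoOp G)) : ℝ≥0∞ :=
  ⨅ x ∈ 𝒢, elementHeight Λ x

/-- `L²(Q)` for a von Neumann subalgebra `Q ⊆ L(G)`: the closure of `Q δ_1` in `L²(L(G)) = ℓ²(G)`. -/
def ltwoSubspace {G : Type*} [Group G] (Q : VonNeumannAlgebra (EllTwo G)) :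
    Submodule ℂ (EllTwo G) :=
  (Submodule.map (ContinuousLinearMap.apply ℂ (EllTwo G) (dirac (1 : G))).toLinearMap
    (Subalgebra.toSubmodule Q.toStarSubalgebra.toSubalgebra)).topologicalClosure

instance {G : Type*} [Group G] (Q : VonNeumannAlgebra (EllTwo G)) :
    CompleteSpace (ltwoSubspace Q) :=
  (Submodule.isClosed_topologicalClosure _).completeSpace_coe

/-- `‖E_Q(x)‖₂` for `x ∈ L(G)`, where `E_Q` is the trace preserving conditional expectation onto
`Q ⊆ L(G)`. As a vector of `L²(L(G)) = ℓ²(G)`, the element `E_Q(x)` is the orthogonal projection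
of `x δ_1` onto `L²(Q)`. -/
def normCondExp {G : Type*} [Group G] (Q : VonNeumannAlgebra (EllTwo G)) (x : EllTwoOp G) : ℝ :=
  ‖(ltwoSubspace Q).starProjection (x (dirac (1 : G)))‖

/-- The unitary group of the von Neumann algebra `P p` on the range of `p`, where `p` is a
projection commuting with `P`. -/
def cornerUnitaries {G : Type*} (P : VonNeumannAlgebra (EllTwo G)) (p : EllTwoOp G) :
    Set (EllTwoOp G) :=
  {u | (∃ a ∈ P, u = a * p) ∧ star u * u = p ∧ u * star u = p}

/-- Popa's intertwining `P p ≺_M Q` inside `M = L(G)`, for von Neumann subalgebras `P, Q ⊆ M` and a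
projection `p ∈ P' ∩ M`: there are finitely many `x_i, y_i ∈ M` and `C > 0` such that
`∑ ‖E_Q(x_i u y_i)‖₂² ≥ C` for all unitaries `u` of `P p`. -/
def CornerIntertwines {G : Type*} [Group G] (P : VonNeumannAlgebra (EllTwo G)) (p : EllTwoOp G)
    (Q : VonNeumannAlgebra (EllTwo G)) : Prop :=
  ∃ (m : ℕ) (x y : Fin m → EllTwoOp G) (C : ℝ),
    (∀ i, x i ∈ groupVN (⊤ : Subgroup G)) ∧ (∀ i, y i ∈ groupVN (⊤ : Subgroup G)) ∧ 0 < C ∧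
    ∀ u ∈ cornerUnitaries P p, C ≤ ∑ i, normCondExp Q (x i * u * y i) ^ 2

/-- Strong intertwining `P ≺^s_M Q` inside `M = L(G)`: `P p ≺_M Q` for every nonzero projection
`p ∈ P' ∩ M`. -/
def StronglyIntertwines {G : Type*} [Group G] (P Q : VonNeumannAlgebra (EllTwo G)) : Prop :=
  ∀ p : EllTwoOp G, IsStarProjection p → p ≠ 0 → p ∈ P.commutant →
    p ∈ groupVN (⊤ : Subgroup G) → CornerIntertwines P p Q

/-- `Σ` is `I`-`J`-fixable with respect to the tuple of subgroups `(Γ_1, …, Γ_n)` of `G`, where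
`I ⊔ J = {1, …, n}` is a partition with `|I| ≥ 2`. The sets `F_i Γ_i K_i` are pointwise products. -/
def IsFixable {G : Type*} [Group G] {n : ℕ} (I J : Finset (Fin n)) (S : Subgroup G)
    (Γ : Fin n → Subgroup G) : Prop :=
  2 ≤ I.card ∧
  ∀ F K : Fin n → Set G, (∀ i, (F i).Finite) → (∀ i, (K i).Finite) →
    ∃ (E : Fin n → Set G) (l : Fin n → ℕ) (σ : (i : Fin n) → Fin (l i) → {g : S // g ≠ 1} → G),
      (∀ j ∈ J, (E j).Finite ∧ E j ⊆ F j * (Γ j : Set G) * K j) ∧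
      (∀ i ∈ I, ∀ k, Function.Injective (σ i k)) ∧
      ∀ (g : {g : S // g ≠ 1}) (h : Fin n → G),
        (∀ i, h i ∈ F i * (Γ i : Set G) * K i ∧ h i ≠ 1) →
        (∀ j ∈ J, h j ∉ E j) →
        ((g : S) : G) * (List.ofFn h).prod = 1 →
        ∀ i ∈ I, ∃ k, h i = σ i k g

end

/-!
Write `P_A` for the restriction of Fourier coefficients to a set `A ⊆ G`, and `‖x‖₂ = ‖x δ_1‖`.

Strong intertwining `P ≺^s L(Λ)` is first turned into approximate containment
(`StronglyIntertwines.exists_finite_approx`): for every `ε` there are finite `F`, `K` such that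
`‖x - P_{FΛK} x‖₂ ≤ ε` for all `x` in the unit ball of `P`. The vectors `ξ` for which the orbit
`(P)_1 ξ` is uniformly concentrated in this sense form a closed subspace `approxSubspace P Λ`. It is
invariant under `P` and under right translations, so its projection lies in `P' ∩ L(G)`. Were the
complementary projection `p` nonzero, `P p` would intertwine into `L(Λ)`. The elements of minimal
Hilbert-Schmidt norm in a convex set of operators, invariant under conjugation by the unitaries of
`P p`, then give almost `P`-central Hilbert-Schmidt operators `T` commuting with right translations
by `Λ`. Such operators are concentrated on finitely many rows modulo `Λ`, and since `T` almost
commutes with `P`, limits of vectors `T η` lie in `approxSubspace P Λ` and in the range of `p`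
(`exists_mem_approxSubspace`), a contradiction.

The restriction `P_{FΛK}` is bounded on `L(G)` in the operator norm (`exists_isMultiplier`). Hence
the factors of the relation `x a^1 ⋯ a^n = 1` can be replaced one after the other by elements `c t`
of uniformly bounded norm supported on `F_t Γ_t K_t`, with a small total error in `‖·‖₂`
(`exists_approx_parameters`). For `j ∈ J`, weak convergence to `0` allows the removal of the
coefficients on any prescribed finite set, at no cost for large `k`.

It remains to bound `τ(x c_1 ⋯ c_n) = ∑_g τ(x u_g*) τ(u_g c_1 ⋯ c_n)`. For `g ≠ 1`, fixability says
that only boundedly many coefficients of `c i₁` and `c i₂`, for two distinct `i₁, i₂ ∈ I`, enter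
`τ(u_g c_1 ⋯ c_n)`, at places depending injectively on `g`. All other coefficients of these two
factors may be dropped (`enorm_groupCoeff_prod_le`), and the square summability of the coefficients
of both factors bounds `∑_g |τ(u_g c_1 ⋯ c_n)|` independently of `x` (`tsum_sum_mul_sum_le`). So
`1 / 2 ≤ |τ(x c_1 ⋯ c_n)| ≤ h_Σ(x) R` with a constant `R`.

Fixability only speaks of tuples with nontrivial entries. In an infinite group, inserting `s s⁻¹`
between consecutive entries removes this restriction (`IsFixable.exists_maps`); for finite `G` the
height is bounded below by Parseval's identity.
-/

noncomputable section

/-! ### Coordinates on `ℓ²(G)` -/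

section Coordinates

variable {G : Type*}

theorem dirac_apply_self (g : G) : dirac g g = 1 := by
  classical
  simp [dirac]

theorem dirac_apply_ne {g h : G} (hne : h ≠ g) : dirac g h = 0 := by
  classical
  simp [dirac, hne]

theorem inner_dirac (g : G) (ξ : EllTwo G) : inner ℂ (dirac g) ξ = ξ g := by
  classical
  rw [dirac]
  convert lp.inner_single_left (𝕜 := ℂ) g (1 : ℂ) ξ using 2
  simp

theorem norm_dirac (g : G) : ‖dirac g‖ = 1 := by
  classical
  simp [dirac]

theorem norm_apply_le (ξ : EllTwo G) (g : G) : ‖ξ g‖ ≤ ‖ξ‖ := by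
  rw [← inner_dirac g ξ]
  simpa [norm_dirac] using norm_inner_le_norm (𝕜 := ℂ) (dirac g) ξ

theorem hasSum_smul_dirac (ξ : EllTwo G) : HasSum (fun g => ξ g • dirac g) ξ := by
  classical
  convert lp.hasSum_single (by norm_num : (2 : ℝ≥0∞) ≠ ∞) ξ using 2 with g
  rw [dirac, ← lp.single_smul]
  simp

/-- A bounded operator is determined by its matrix `(s, r) ↦ (A δ_r)(s)`. -/
theorem hasSum_matrix (A : EllTwoOp G) (ξ : EllTwo G) (s : G) :
    HasSum (fun r => ξ r * A (dirac r) s) (A ξ s) := by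
  have h := (hasSum_smul_dirac ξ).mapL ((innerSL ℂ (dirac s)).comp A)
  simpa [inner_smul_right, inner_dirac] using h

theorem op_ext {A B : EllTwoOp G} (h : ∀ r s, A (dirac r) s = B (dirac r) s) : A = B := by
  ext ξ s
  refine (hasSum_matrix A ξ s).unique ?_
  simpa [h] using hasSum_matrix B ξ s

theorem star_apply_dirac (A : EllTwoOp G) (r s : G) :
    star A (dirac r) s = star (A (dirac s) r) := by
  rw [← inner_dirac s, ContinuousLinearMap.star_eq_adjoint,
    ContinuousLinearMap.adjoint_inner_right, ← inner_conj_symm, inner_dirac]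
  rfl

theorem norm_star_op (A : EllTwoOp G) : ‖star A‖ = ‖A‖ :=
  ContinuousLinearMap.adjoint.norm_map A

theorem enorm_sq_eq_tsum (ξ : EllTwo G) : ‖ξ‖ₑ ^ 2 = ∑' g, ‖ξ g‖ₑ ^ 2 := by
  have h := lp.hasSum_norm (by norm_num) ξ
  simp only [ENNReal.toReal_ofNat, Real.rpow_ofNat] at h
  have h2 := ENNReal.ofReal_tsum_of_nonneg (fun g => by positivity) h.summable
  rw [h.tsum_eq] at h2
  simpa [ENNReal.ofReal_pow, ofReal_norm] using h2

theorem memℓp_two_of_tsum_ne_top {f : G → ℂ} (h : ∑' g, ‖f g‖ₑ ^ 2 ≠ ∞) : Memℓp f 2 := by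
  refine (memℓp_gen_iff (by norm_num)).mpr ?_
  have := ENNReal.summable_toReal h
  simpa using this

/-- Multiplication by the indicator function of `A`, the orthogonal projection of `ℓ²(G)` onto
`ℓ²(A)`. -/
def restrict (A : Set G) : EllTwoOp G :=
  LinearMap.mkContinuous
    { toFun := fun ξ => ⟨A.indicator ξ, by
        refine memℓp_two_of_tsum_ne_top (ne_top_of_le_ne_top
          (b := ‖ξ‖ₑ ^ 2) (by finiteness) ?_)
        rw [enorm_sq_eq_tsum]
        refine ENNReal.tsum_le_tsum fun g => ?_
        gcongr
        by_cases hg : g ∈ A <;> simp [hg]⟩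
      map_add' := fun ξ η => by
        ext g
        exact congrFun (Set.indicator_add A ξ η) g
      map_smul' := fun c ξ => by
        ext g
        exact congrFun (Set.indicator_const_smul A c ξ) g } 1 (fun ξ => by
    rw [one_mul, ← enorm_le_iff_norm_le, ← ENNReal.pow_le_pow_left_iff two_ne_zero,
      enorm_sq_eq_tsum, enorm_sq_eq_tsum]
    refine ENNReal.tsum_le_tsum fun g => ?_
    gcongr
    by_cases hg : g ∈ A <;> simp [hg])

theorem restrict_apply (A : Set G) (ξ : EllTwo G) (g : G) :
    restrict A ξ g = A.indicator ξ g := rfl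

theorem restrict_apply_of_mem {A : Set G} {g : G} (hg : g ∈ A) (ξ : EllTwo G) :
    restrict A ξ g = ξ g := by
  simp [restrict_apply, hg]

theorem restrict_apply_of_notMem {A : Set G} {g : G} (hg : g ∉ A) (ξ : EllTwo G) :
    restrict A ξ g = 0 := by
  simp [restrict_apply, hg]

theorem norm_restrict_le_of_subset {A B : Set G} (h : A ⊆ B) (ξ : EllTwo G) :
    ‖restrict A ξ‖ ≤ ‖restrict B ξ‖ := by
  rw [← enorm_le_iff_norm_le, ← ENNReal.pow_le_pow_left_iff two_ne_zero,
    enorm_sq_eq_tsum, enorm_sq_eq_tsum]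
  refine ENNReal.tsum_le_tsum fun g => ?_
  gcongr
  by_cases hg : g ∈ A
  · simp [restrict_apply, hg, h hg]
  · simp [restrict_apply, hg]

theorem norm_restrict_le (A : Set G) (ξ : EllTwo G) : ‖restrict A ξ‖ ≤ ‖ξ‖ := by
  have h : restrict Set.univ ξ = ξ := by
    ext g
    simp [restrict_apply]
  simpa [h] using norm_restrict_le_of_subset (Set.subset_univ A) ξ

theorem restrict_dirac_of_mem {A : Set G} {g : G} (hg : g ∈ A) :
    restrict A (dirac g) = dirac g := by
  ext h
  by_cases hh : h = g
  · subst hh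
    simp [restrict_apply, hg]
  · by_cases hA : h ∈ A <;> simp [restrict_apply, hA, dirac_apply_ne hh]

theorem restrict_dirac_of_notMem {A : Set G} {g : G} (hg : g ∉ A) :
    restrict A (dirac g) = 0 := by
  ext h
  by_cases hh : h = g
  · subst hh
    simp [restrict_apply, hg]
  · by_cases hA : h ∈ A <;> simp [restrict_apply, hA, dirac_apply_ne hh]

theorem star_restrict (A : Set G) : star (restrict A) = restrict A := by
  refine op_ext fun r s => ?_
  rw [star_apply_dirac]
  by_cases hrs : s = r
  · subst hrs
    by_cases hA : s ∈ A <;> simp [restrict_apply, hA, dirac_apply_self]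
  · have hsr : r ≠ s := fun h => hrs h.symm
    by_cases hr : r ∈ A <;> by_cases hs : s ∈ A <;>
      simp [restrict_apply, hr, hs, dirac_apply_ne hrs, dirac_apply_ne hsr]

theorem restrict_mul_self (A : Set G) : restrict A * restrict A = restrict A := by
  ext ξ g
  by_cases hg : g ∈ A <;> simp [restrict_apply, hg]

end Coordinates

/-! ### Right translations and their commutant -/

section RightCommutant

variable {G : Type*} [Group G]

/-- The isometry `ρ_g` of the right regular representation: `(ρ_g ξ)(h) = ξ (h g)`. -/
def rightRegularIsometry (g : G) : EllTwo G →ₗᵢ[ℂ] EllTwo G where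
  toFun ξ := ⟨fun h => ξ (h * g), by
    have hξ := (memℓp_gen_iff (by norm_num)).mp (lp.memℓp ξ)
    exact (memℓp_gen_iff (by norm_num)).mpr ((Equiv.mulRight g).summable_iff.mpr hξ)⟩
  map_add' ξ η := by ext h; rfl
  map_smul' c ξ := by ext h; rfl
  norm_map' ξ := by
    rw [lp.norm_eq_tsum_rpow (by norm_num), lp.norm_eq_tsum_rpow (by norm_num)]
    congr 1
    exact (Equiv.mulRight g).tsum_eq (fun h => ‖ξ h‖ ^ (2 : ℝ≥0∞).toReal)

/-- The operators `ρ_g` of the right regular representation. -/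
def rightRegular (g : G) : EllTwoOp G := (rightRegularIsometry g).toContinuousLinearMap

theorem rightRegular_apply (g h : G) (ξ : EllTwo G) : rightRegular g ξ h = ξ (h * g) := rfl

theorem norm_rightRegular_apply (g : G) (ξ : EllTwo G) : ‖rightRegular g ξ‖ = ‖ξ‖ :=
  (rightRegularIsometry g).norm_map ξ

theorem norm_leftRegular_apply (g : G) (ξ : EllTwo G) : ‖leftRegular g ξ‖ = ‖ξ‖ :=
  (leftRegularIsometry g).norm_map ξ

theorem norm_leftRegular_le (g : G) : ‖leftRegular g‖ ≤ 1 :=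
  ContinuousLinearMap.opNorm_le_bound _ zero_le_one fun ξ => by
    rw [norm_leftRegular_apply, one_mul]

theorem rightRegular_dirac (g h : G) : rightRegular g (dirac h) = dirac (h * g⁻¹) := by
  ext k
  rw [rightRegular_apply]
  by_cases hk : k = h * g⁻¹
  · subst hk
    simp [dirac_apply_self]
  · rw [dirac_apply_ne hk, dirac_apply_ne (fun h' => hk (eq_mul_inv_of_mul_eq h'))]

theorem star_rightRegular (g : G) : star (rightRegular g) = rightRegular g⁻¹ := by
  refine op_ext fun r s => ?_
  rw [star_apply_dirac, rightRegular_apply, rightRegular_apply]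
  by_cases h : r * g = s
  · subst h
    simp [dirac_apply_self]
  · rw [dirac_apply_ne h, dirac_apply_ne, star_zero]
    rintro rfl
    simp at h

theorem star_leftRegular (g : G) : star (leftRegular g) = leftRegular g⁻¹ := by
  refine op_ext fun r s => ?_
  rw [star_apply_dirac, leftRegular_apply, leftRegular_apply]
  by_cases h : g⁻¹ * r = s
  · subst h
    simp [dirac_apply_self]
  · rw [dirac_apply_ne h, dirac_apply_ne, star_zero]
    rintro rfl
    simp at h

/-- The commutant of the right translations by elements of `Λ`. For `Λ = G` this is `L(G)`; for a
smaller `Λ` it is the basic construction of `L(Λ) ⊆ L(G)`. -/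
def rightCommutant (Λ : Subgroup G) : StarSubalgebra ℂ (EllTwoOp G) :=
  StarSubalgebra.centralizer ℂ (rightRegular '' (Λ : Set G))

theorem mem_rightCommutant_iff_commute {Λ : Subgroup G} {T : EllTwoOp G} :
    T ∈ rightCommutant Λ ↔ ∀ g ∈ Λ, rightRegular g * T = T * rightRegular g := by
  rw [rightCommutant, StarSubalgebra.mem_centralizer_iff]
  constructor
  · intro h g hg
    exact (h _ ⟨g, hg, rfl⟩).1
  · rintro h _ ⟨g, hg, rfl⟩
    refine ⟨h g hg, ?_⟩
    rw [star_rightRegular]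
    exact h _ (Λ.inv_mem hg)

/-- In terms of matrices, commuting with right translations is invariance under the diagonal right
translations of `G × G`. -/
theorem mem_rightCommutant_iff {Λ : Subgroup G} {T : EllTwoOp G} :
    T ∈ rightCommutant Λ ↔
      ∀ g ∈ Λ, ∀ t s, T (dirac (t * g)) (s * g) = T (dirac t) s := by
  rw [mem_rightCommutant_iff_commute]
  constructor
  · intro h g hg t s
    have := congrArg (fun A : EllTwoOp G => A (dirac (t * g)) s) (h g hg)
    simpa [rightRegular_apply, rightRegular_dirac] using this
  · intro h g hg
    refine op_ext fun t s => ?_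
    have := h g hg (t * g⁻¹) s
    simpa [rightRegular_apply, rightRegular_dirac] using this

theorem rightCommutant_anti {Λ Λ' : Subgroup G} (h : Λ ≤ Λ') :
    rightCommutant Λ' ≤ rightCommutant Λ := by
  intro T hT
  rw [mem_rightCommutant_iff] at hT ⊢
  exact fun g hg => hT g (h hg)

theorem leftRegular_mem_rightCommutant (g : G) (Λ : Subgroup G) :
    leftRegular g ∈ rightCommutant Λ := by
  rw [mem_rightCommutant_iff_commute]
  intro h _
  ext ξ k
  simp [leftRegular_apply, rightRegular_apply, mul_assoc]

theorem restrict_mem_rightCommutant {A : Set G} {Λ : Subgroup G}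
    (hA : ∀ a, ∀ g ∈ Λ, a * g ∈ A ↔ a ∈ A) : restrict A ∈ rightCommutant Λ := by
  rw [mem_rightCommutant_iff_commute]
  intro h hh
  ext ξ k
  have := hA k h hh
  by_cases hk : k ∈ A <;> simp_all [restrict_apply, rightRegular_apply]

theorem apply_dirac_eq {T : EllTwoOp G} (hT : T ∈ rightCommutant (⊤ : Subgroup G)) (t s : G) :
    T (dirac t) s = T (dirac 1) (s * t⁻¹) := by
  have := mem_rightCommutant_iff.mp hT t⁻¹ trivial t s
  rw [← this, mul_inv_cancel]

theorem groupVN_le_rightCommutant {Λ : Subgroup G} {T : EllTwoOp G} (h : T ∈ groupVN Λ) :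
    T ∈ rightCommutant (⊤ : Subgroup G) := by
  rw [mem_rightCommutant_iff_commute]
  intro g _
  refine ((StarSubalgebra.mem_centralizer_iff ℂ).mp h (rightRegular g) ?_).1
  refine (StarSubalgebra.mem_centralizer_iff ℂ).mpr ?_
  rintro _ ⟨k, -, rfl⟩
  rw [star_leftRegular]
  exact ⟨(mem_rightCommutant_iff_commute.mp (leftRegular_mem_rightCommutant k ⊤) g trivial).symm,
    (mem_rightCommutant_iff_commute.mp (leftRegular_mem_rightCommutant k⁻¹ ⊤) g trivial).symm⟩

/-- The commutation theorem for the regular representations: `L(G)` is the commutant of the right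
translations. -/
theorem mem_groupVN_top_iff {T : EllTwoOp G} :
    T ∈ groupVN (⊤ : Subgroup G) ↔ T ∈ rightCommutant (⊤ : Subgroup G) := by
  refine ⟨groupVN_le_rightCommutant, fun h => ?_⟩
  have key : ∀ B ∈ StarSubalgebra.centralizer ℂ (leftRegular '' ((⊤ : Subgroup G) : Set G)),
      B * T = T * B := by
    intro B hB
    have hBe : ∀ g t s, B (dirac (g * t)) (g * s) = B (dirac t) s := by
      intro g t s
      have h1 := ((StarSubalgebra.mem_centralizer_iff ℂ).mp hB _ ⟨g, trivial, rfl⟩).1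
      have h2 := congrArg (fun A : EllTwoOp G => A (dirac t) (g * s)) h1
      simpa [leftRegular_apply, leftRegular_dirac] using h2.symm
    have hTe := mem_rightCommutant_iff.mp h
    refine op_ext fun t s => ?_
    have h1 := hasSum_matrix B (T (dirac t)) s
    have h2 := hasSum_matrix T (B (dirac t)) s
    -- The two matrix products are matched by the substitution `r ↦ s r⁻¹ t`.
    let e : G ≃ G := ((Equiv.inv G).trans (Equiv.mulLeft s)).trans (Equiv.mulRight t)
    refine h1.unique ((e.hasSum_iff.mp ?_))
    convert h2 using 1
    · funext r
      have e1 : T (dirac t) (s * r⁻¹ * t) = T (dirac r) s := by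
        rw [← hTe (t⁻¹ * r) trivial t (s * r⁻¹ * t)]
        simp [← mul_assoc]
      have e2 : B (dirac (s * r⁻¹ * t)) s = B (dirac t) r := by
        rw [← hBe (s * r⁻¹) t r]
        simp
      simp [e, e1, e2, mul_comm]
    · rfl
  refine (StarSubalgebra.mem_centralizer_iff ℂ).mpr fun B hB => ⟨key B hB, ?_⟩
  exact key _ (star_mem hB)

end RightCommutant

/-! ### The trace on the commutant of right translations by a subgroup -/

section HilbertSchmidt

variable {G : Type*} [Group G]

/-- Representatives of the left cosets of `Λ` factor every element of `G` uniquely. -/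
def quotientProdEquiv (Λ : Subgroup G) : (G ⧸ Λ) × Λ ≃ G :=
  Equiv.ofBijective (fun q => q.1.out * (q.2 : G)) (by
    constructor
    · rintro ⟨a, l⟩ ⟨b, m⟩ h
      have hab : a = b := by
        have := congrArg (QuotientGroup.mk (s := Λ)) h
        simpa using this
      subst hab
      simpa using h
    · intro g
      refine ⟨⟨QuotientGroup.mk g, ⟨(QuotientGroup.mk (s := Λ) g).out⁻¹ * g, ?_⟩⟩, by simp⟩
      exact QuotientGroup.eq.mp (QuotientGroup.out_eq' _))

theorem quotientProdEquiv_apply (Λ : Subgroup G) (a : G ⧸ Λ) (l : Λ) :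
    quotientProdEquiv Λ (a, l) = a.out * (l : G) := rfl

/-- The squared Hilbert-Schmidt norm `Tr(T* T)` for the canonical semifinite trace
`Tr(X) = ∑ ⟨X δ_t, δ_t⟩`, `t` running over representatives of `G / Λ`, on the commutant of the right
translations by `Λ`. -/
def hsSq (Λ : Subgroup G) (T : EllTwoOp G) : ℝ≥0∞ :=
  ∑' t : G ⧸ Λ, ‖T (dirac t.out)‖ₑ ^ 2

/-- The trace property `Tr(T T*) = Tr(T* T)`. -/
theorem hsSq_star {Λ : Subgroup G} {T : EllTwoOp G} (hT : T ∈ rightCommutant Λ) :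
    hsSq Λ (star T) = hsSq Λ T := by
  have expand : ∀ S : EllTwoOp G, hsSq Λ S =
      ∑' a : G ⧸ Λ, ∑' b : G ⧸ Λ, ∑' l : Λ, ‖S (dirac a.out) (b.out * l)‖ₑ ^ 2 := by
    intro S
    refine tsum_congr fun a => ?_
    rw [enorm_sq_eq_tsum, ← (quotientProdEquiv Λ).tsum_eq, ENNReal.tsum_prod']
    rfl
  rw [expand, expand, ENNReal.tsum_comm]
  refine tsum_congr fun a => tsum_congr fun b => ?_
  rw [← (Equiv.inv Λ).tsum_eq]
  refine tsum_congr fun l => ?_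
  rw [star_apply_dirac, ← ofReal_norm, norm_star, ofReal_norm]
  have := mem_rightCommutant_iff.mp hT l l.2 (a.out * (l : G)⁻¹) b.out
  simp only [inv_mul_cancel_right] at this
  simp [this]

theorem enorm_apply_dirac_sq_le {Λ : Subgroup G} {T : EllTwoOp G} (hT : T ∈ rightCommutant Λ)
    (g : G) : ‖T (dirac g)‖ₑ ^ 2 ≤ hsSq Λ T := by
  obtain ⟨⟨a, l⟩, rfl⟩ := (quotientProdEquiv Λ).surjective g
  have h : T (dirac (a.out * (l : G))) = rightRegular (l : G)⁻¹ (T (dirac a.out)) := by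
    have := congrArg (fun A : EllTwoOp G => A (dirac a.out))
      (mem_rightCommutant_iff_commute.mp hT _ (Λ.inv_mem l.2))
    simpa [rightRegular_dirac] using this.symm
  have h' : ‖T (dirac (a.out * (l : G)))‖ₑ = ‖T (dirac a.out)‖ₑ := by
    rw [h, ← ofReal_norm, norm_rightRegular_apply, ofReal_norm]
  rw [quotientProdEquiv_apply, h']
  exact ENNReal.le_tsum (f := fun t : G ⧸ Λ => ‖T (dirac t.out)‖ₑ ^ 2) a

theorem hsSq_mul_left (Λ : Subgroup G) (A T : EllTwoOp G) :
    hsSq Λ (A * T) ≤ ‖A‖ₑ ^ 2 * hsSq Λ T := by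
  rw [hsSq, hsSq, ← ENNReal.tsum_mul_left]
  refine ENNReal.tsum_le_tsum fun t => ?_
  rw [← mul_pow]
  gcongr
  exact A.le_opENorm _

/-- Right multiplication by elements of `L(G)` is bounded because of the trace property. -/
theorem hsSq_mul_right {Λ : Subgroup G} {A T : EllTwoOp G} (hA : A ∈ rightCommutant Λ)
    (hT : T ∈ rightCommutant Λ) : hsSq Λ (T * A) ≤ ‖A‖ₑ ^ 2 * hsSq Λ T := by
  rw [← hsSq_star (mul_mem hT hA), ← hsSq_star hT, star_mul]
  refine (hsSq_mul_left _ _ _).trans_eq ?_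
  rw [← ofReal_norm, norm_star_op, ofReal_norm]

theorem hsSq_parallelogram (Λ : Subgroup G) (A B : EllTwoOp G) :
    hsSq Λ (A + B) + hsSq Λ (A - B) = 2 * (hsSq Λ A + hsSq Λ B) := by
  rw [hsSq, hsSq, hsSq, hsSq, ← ENNReal.tsum_add, ← ENNReal.tsum_add, ← ENNReal.tsum_mul_left]
  refine tsum_congr fun t => ?_
  have h := parallelogram_law_with_norm ℂ (A (dirac t.out)) (B (dirac t.out))
  simp only [add_apply, sub_apply, ← ofReal_norm,
    ← ENNReal.ofReal_pow (norm_nonneg _)]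
  rw [← ENNReal.ofReal_add (by positivity) (by positivity),
    ← ENNReal.ofReal_add (by positivity) (by positivity), h,
    ENNReal.ofReal_mul (by positivity), ENNReal.ofReal_ofNat]

theorem hsSq_add_le (Λ : Subgroup G) (A B : EllTwoOp G) :
    hsSq Λ (A + B) ≤ 2 * (hsSq Λ A + hsSq Λ B) :=
  (hsSq_parallelogram Λ A B) ▸ le_self_add

theorem hsSq_smul (Λ : Subgroup G) (c : ℂ) (A : EllTwoOp G) :
    hsSq Λ (c • A) = ‖c‖ₑ ^ 2 * hsSq Λ A := by
  rw [hsSq, hsSq, ← ENNReal.tsum_mul_left]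
  refine tsum_congr fun t => ?_
  simp [enorm_smul, mul_pow]

theorem hsSq_restrict_le (Λ : Subgroup G) : hsSq Λ (restrict (Λ : Set G)) ≤ 1 := by
  rw [hsSq, tsum_eq_single (QuotientGroup.mk (1 : G))]
  · rw [← ofReal_norm, ← ENNReal.ofReal_pow (norm_nonneg _)]
    refine ENNReal.ofReal_le_one.mpr (pow_le_one₀ (norm_nonneg _) ?_)
    exact (norm_restrict_le _ _).trans_eq (norm_dirac _)
  · intro t ht
    rw [restrict_dirac_of_notMem]
    · simp
    · intro h
      refine ht ?_
      rw [← QuotientGroup.out_eq' t]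
      exact (QuotientGroup.eq.mpr (by simpa using h)).symm

/-- The matrix of a Hilbert-Schmidt operator is concentrated, up to a small error, on finitely many
rows modulo `Λ`. -/
theorem exists_finite_hsSq_restrict_le {Λ : Subgroup G} {T : EllTwoOp G}
    (hT : T ∈ rightCommutant Λ) (hfin : hsSq Λ T ≠ ∞) {ε : ℝ≥0∞} (hε : 0 < ε) :
    ∃ F : Set G, F.Finite ∧ hsSq Λ (restrict (F * (Λ : Set G))ᶜ * T) ≤ ε ∧
      restrict (F * (Λ : Set G))ᶜ ∈ rightCommutant Λ := by
  have hfin' : ∑' t : G ⧸ Λ, ‖star T (dirac t.out)‖ₑ ^ 2 ≠ ∞ := by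
    have := hsSq_star hT
    rw [hsSq] at this
    rwa [this]
  obtain ⟨s, hs⟩ := ((tendsto_order.1 (ENNReal.tendsto_tsum_compl_atTop_zero hfin')).2 ε hε).exists
  refine ⟨Quotient.out '' (s : Set (G ⧸ Λ)), s.finite_toSet.image _, ?_⟩
  set A : Set G := Quotient.out '' (s : Set (G ⧸ Λ)) * (Λ : Set G) with hA
  have hmem : restrict Aᶜ ∈ rightCommutant Λ := by
    refine restrict_mem_rightCommutant fun a g hg => ?_
    have : A * (Λ : Set G) = A := by simp [hA, mul_assoc]
    rw [Set.mem_compl_iff, Set.mem_compl_iff, not_iff_not]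
    constructor
    · intro h
      rw [← this]
      exact ⟨a * g, h, g⁻¹, Λ.inv_mem hg, by simp⟩
    · intro h
      rw [← this]
      exact ⟨a, h, g, hg, rfl⟩
  refine ⟨?_, hmem⟩
  rw [← hsSq_star (mul_mem hmem hT), star_mul, star_restrict]
  refine le_trans ?_ hs.le
  rw [hsSq]
  refine le_of_eq ?_
  rw [← tsum_subtype_eq_of_support_subset (s := {t : G ⧸ Λ | t ∉ s})]
  · refine tsum_congr fun t => ?_
    rw [mul_apply_eq_comp, restrict_dirac_of_mem]
    rintro ⟨_, ⟨b, hb, rfl⟩, l, hl, h⟩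
    refine t.2 ?_
    have : (t : G ⧸ Λ) = b := by
      rw [← QuotientGroup.out_eq' (t : G ⧸ Λ), ← QuotientGroup.out_eq' b]
      refine (QuotientGroup.eq.mpr ?_).symm
      rw [← h]
      simpa using hl
    rw [this]
    exact hb
  · intro t ht hts
    refine ht ?_
    have : t.out ∉ Aᶜ := fun h => h ⟨t.out, ⟨t, hts, rfl⟩, 1, Λ.one_mem, by simp⟩
    simp [restrict_dirac_of_notMem this]

/-- A sequence minimizing the Hilbert-Schmidt norm on a midpoint convex set is Cauchy, and close to
every element of no larger norm. -/
theorem exists_minimizing_seq (Λ : Subgroup G) {K : Set (EllTwoOp G)} (hne : K.Nonempty)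
    (hfin : ∀ T ∈ K, hsSq Λ T ≠ ∞)
    (hmid : ∀ A ∈ K, ∀ B ∈ K, (2⁻¹ : ℂ) • (A + B) ∈ K) :
    ∃ T : ℕ → EllTwoOp G, (∀ n, T n ∈ K) ∧ ∀ ε : ℝ≥0∞, 0 < ε → ∃ N, ∀ n ≥ N,
      (∀ A ∈ K, hsSq Λ A ≤ hsSq Λ (T n) → hsSq Λ (T n - A) ≤ ε) ∧
      ∀ m ≥ N, hsSq Λ (T n - T m) ≤ ε := by
  set μ : ℝ≥0∞ := ⨅ T ∈ K, hsSq Λ T with hμ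
  have hμle : ∀ T ∈ K, μ ≤ hsSq Λ T := fun T hT => iInf₂_le T hT
  have hμfin : μ ≠ ∞ := by
    obtain ⟨T, hT⟩ := hne
    exact ne_top_of_le_ne_top (hfin T hT) (hμle T hT)
  have close : ∀ ε : ℝ≥0∞, ∀ A ∈ K, ∀ B ∈ K, hsSq Λ A ≤ μ + ε → hsSq Λ B ≤ μ + ε →
      hsSq Λ (A - B) ≤ 4 * ε := by
    intro ε A hA B hB hAε hBε
    have h1 := hsSq_parallelogram Λ A B
    have h2 := hμle _ (hmid A hA B hB)
    rw [hsSq_smul] at h2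
    have h3 : ‖(2⁻¹ : ℂ)‖ₑ ^ 2 = 4⁻¹ := by
      rw [enorm_inv (by norm_num), ← ofReal_norm]
      rw [← ENNReal.inv_pow]
      norm_num
    rw [h3] at h2
    have h4 : 4 * μ ≤ hsSq Λ (A + B) := by
      calc 4 * μ ≤ 4 * (4⁻¹ * hsSq Λ (A + B)) := by gcongr
        _ = hsSq Λ (A + B) := by
          rw [← mul_assoc, ENNReal.mul_inv_cancel (by norm_num) (by norm_num), one_mul]
    have h5 : 4 * μ + hsSq Λ (A - B) ≤ 4 * μ + 4 * ε := by
      calc 4 * μ + hsSq Λ (A - B) ≤ hsSq Λ (A + B) + hsSq Λ (A - B) := by gcongr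
        _ = 2 * (hsSq Λ A + hsSq Λ B) := h1
        _ ≤ 2 * ((μ + ε) + (μ + ε)) := by gcongr
        _ = 4 * μ + 4 * ε := by ring
    exact (ENNReal.add_le_add_iff_left (by finiteness)).mp h5
  have hex : ∀ n : ℕ, ∃ T ∈ K, hsSq Λ T ≤ μ + ((n : ℝ≥0∞) + 1)⁻¹ := by
    intro n
    by_contra! hcon
    have h1 : μ + ((n : ℝ≥0∞) + 1)⁻¹ ≤ μ := le_iInf₂ fun T hT => (hcon T hT).le
    exact absurd h1 (not_le.mpr (ENNReal.lt_add_right hμfin (by simp)))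
  choose T hTK hTμ using hex
  refine ⟨T, hTK, fun ε hε => ?_⟩
  obtain ⟨N, hN⟩ := ENNReal.exists_inv_nat_lt
    (ENNReal.div_pos hε.ne' (by norm_num : (4 : ℝ≥0∞) ≠ ∞)).ne'
  have hle : ∀ n ≥ N, hsSq Λ (T n) ≤ μ + ε / 4 := by
    intro n hn
    refine (hTμ n).trans ?_
    gcongr
    refine le_trans ?_ hN.le
    rw [ENNReal.inv_le_inv]
    have : (N : ℝ≥0∞) ≤ n := by exact_mod_cast hn
    exact this.trans le_self_add
  have h4 : 4 * (ε / 4) = ε := ENNReal.mul_div_cancel (by norm_num) (by norm_num)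
  refine ⟨N, fun n hn => ⟨fun A hA hAn => ?_, fun m hm => ?_⟩⟩
  · exact (close (ε / 4) _ (hTK n) A hA (hle n hn) (hAn.trans (hle n hn))).trans_eq h4
  · exact (close (ε / 4) _ (hTK n) _ (hTK m) (hle n hn) (hle m hm)).trans_eq h4

end HilbertSchmidt

/-! ### Strong intertwining and uniform approximation -/

section Approximation

theorem starProjection_commute {H : Type*} [NormedAddCommGroup H] [InnerProductSpace ℂ H]
    [CompleteSpace H] (V : Submodule ℂ H) [V.HasOrthogonalProjection] {y : H →L[ℂ] H}
    (h₁ : ∀ ξ ∈ V, y ξ ∈ V) (h₂ : ∀ ξ ∈ V, star y ξ ∈ V) :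
    V.starProjection * y = y * V.starProjection := by
  ext ξ
  refine Submodule.eq_starProjection_of_mem_orthogonal
    (h₁ _ (Submodule.starProjection_apply_mem _ _)) ?_
  rw [Submodule.mem_orthogonal]
  intro η hη
  rw [mul_apply_eq_comp]
  change inner ℂ η (y ξ - y (V.starProjection ξ)) = 0
  rw [← map_sub, ← ContinuousLinearMap.adjoint_inner_left]
  exact (Submodule.mem_orthogonal _ _).mp (Submodule.sub_starProjection_mem_orthogonal ξ) _
    (h₂ η hη)

theorem exists_sum_four_unitary_mem {A : Type*} [CStarAlgebra A] (S : StarSubalgebra ℂ A)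
    (hS : IsClosed (S : Set A)) {a : A} (ha : a ∈ S) :
    ∃ (u : Fin 4 → A) (c : Fin 4 → ℂ), (∀ i, u i ∈ S ∧ u i ∈ unitary A) ∧
      a = ∑ i, c i • u i ∧ ∀ i, ‖c i‖ ≤ ‖a‖ / 2 := by
  let _ : CStarAlgebra S := StarSubalgebra.cstarAlgebra S (h_closed := hS)
  obtain ⟨u, c, hx, hc⟩ := CStarAlgebra.exists_sum_four_unitary (⟨a, ha⟩ : S)
  refine ⟨fun i => ((u i : S) : A), c, fun i => ⟨(u i : S).2, ?_⟩, ?_, hc⟩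
  · have h := (u i).2
    exact Unitary.mem_iff.mpr ⟨congrArg Subtype.val (Unitary.mem_iff.mp h).1,
      congrArg Subtype.val (Unitary.mem_iff.mp h).2⟩
  · have := congrArg S.subtype hx
    rw [map_sum] at this
    exact this

/-- A bound for the unitaries of a von Neumann algebra gives a bound for its unit ball, as every
contraction is a combination of four unitaries with coefficients of modulus at most `1 / 2`. -/
theorem norm_apply_le_of_unitary {H : Type*} [NormedAddCommGroup H] [InnerProductSpace ℂ H]
    [CompleteSpace H] (P : VonNeumannAlgebra H) (B : H →L[ℂ] H) (ξ : H) {ε : ℝ}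
    (h : ∀ w ∈ P, w ∈ unitary (H →L[ℂ] H) → ‖B (w ξ)‖ ≤ ε) {a : H →L[ℂ] H} (ha : a ∈ P)
    (ha1 : ‖a‖ ≤ 1) : ‖B (a ξ)‖ ≤ 2 * ε := by
  have hclosed : IsClosed (P.toStarSubalgebra : Set (H →L[ℂ] H)) := by
    rw [VonNeumannAlgebra.coe_toStarSubalgebra, ← VonNeumannAlgebra.centralizer_centralizer P]
    exact Set.isClosed_centralizer _
  obtain ⟨u, c, hu, hx, hc⟩ := exists_sum_four_unitary_mem P.toStarSubalgebra hclosed ha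
  rw [hx]
  simp only [sum_apply, map_sum, smul_apply, map_smul]
  refine (norm_sum_le _ _).trans ?_
  have hterm : ∀ i, ‖c i • B (u i ξ)‖ ≤ 1 / 2 * ε := by
    intro i
    rw [norm_smul]
    exact mul_le_mul ((hc i).trans (by linarith)) (h _ (hu i).1 (hu i).2) (norm_nonneg _)
      (by norm_num)
  refine (Finset.sum_le_sum fun i _ => hterm i).trans_eq ?_
  simp
  ring

variable {G : Type*} [Group G]

/-- The vectors `ξ` for which the bounded orbit `(P)_1 ξ` is uniformly concentrated on sets of the
form `F Λ K` with `F` and `K` finite. -/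
def approxSubspace (P : VonNeumannAlgebra (EllTwo G)) (Λ : Subgroup G) :
    Submodule ℂ (EllTwo G) where
  carrier := {ξ | ∀ ε : ℝ, 0 < ε → ∃ F K : Set G, F.Finite ∧ K.Finite ∧
    ∀ a ∈ P, ‖a‖ ≤ 1 → ‖restrict (F * (Λ : Set G) * K)ᶜ (a ξ)‖ ≤ ε}
  add_mem' {ξ η} hξ hη ε hε := by
    obtain ⟨F, K, hF, hK, h⟩ := hξ (ε / 2) (by positivity)
    obtain ⟨F', K', hF', hK', h'⟩ := hη (ε / 2) (by positivity)
    refine ⟨F ∪ F', K ∪ K', hF.union hF', hK.union hK', fun a ha ha1 => ?_⟩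
    rw [map_add, map_add]
    refine (norm_add_le _ _).trans ?_
    have h1 : ‖restrict ((F ∪ F') * (Λ : Set G) * (K ∪ K'))ᶜ (a ξ)‖ ≤ ε / 2 :=
      (norm_restrict_le_of_subset (Set.compl_subset_compl.mpr (by gcongr <;> simp)) _).trans
        (h a ha ha1)
    have h2 : ‖restrict ((F ∪ F') * (Λ : Set G) * (K ∪ K'))ᶜ (a η)‖ ≤ ε / 2 :=
      (norm_restrict_le_of_subset (Set.compl_subset_compl.mpr (by gcongr <;> simp)) _).trans
        (h' a ha ha1)
    linarith
  zero_mem' ε hε := ⟨∅, ∅, Set.finite_empty, Set.finite_empty, fun a _ _ => by simpa using hε.le⟩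
  smul_mem' c ξ hξ ε hε := by
    obtain ⟨F, K, hF, hK, h⟩ := hξ (ε / (‖c‖ + 1)) (by positivity)
    refine ⟨F, K, hF, hK, fun a ha ha1 => ?_⟩
    rw [map_smul, map_smul, norm_smul]
    have := h a ha ha1
    rw [le_div_iff₀ (by positivity)] at this
    nlinarith [norm_nonneg (restrict (F * (Λ : Set G) * K)ᶜ (a ξ)), norm_nonneg c]

theorem mem_approxSubspace {P : VonNeumannAlgebra (EllTwo G)} {Λ : Subgroup G} {ξ : EllTwo G} :
    ξ ∈ approxSubspace P Λ ↔ ∀ ε : ℝ, 0 < ε → ∃ F K : Set G, F.Finite ∧ K.Finite ∧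
      ∀ a ∈ P, ‖a‖ ≤ 1 → ‖restrict (F * (Λ : Set G) * K)ᶜ (a ξ)‖ ≤ ε := Iff.rfl

theorem isClosed_approxSubspace (P : VonNeumannAlgebra (EllTwo G)) (Λ : Subgroup G) :
    IsClosed (approxSubspace P Λ : Set (EllTwo G)) := by
  refine isClosed_of_closure_subset fun ξ hξ ε hε => ?_
  obtain ⟨η, hη, hd⟩ := Metric.mem_closure_iff.mp hξ (ε / 2) (by positivity)
  obtain ⟨F, K, hF, hK, h⟩ := hη (ε / 2) (by positivity)
  refine ⟨F, K, hF, hK, fun a ha ha1 => ?_⟩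
  have hsplit : a ξ = a (ξ - η) + a η := by rw [← map_add, sub_add_cancel]
  rw [hsplit, map_add]
  refine (norm_add_le _ _).trans ?_
  have h1 := h a ha ha1
  have h2 := (norm_restrict_le (F * (Λ : Set G) * K)ᶜ (a (ξ - η))).trans (a.le_opNorm _)
  rw [dist_eq_norm] at hd
  nlinarith [norm_nonneg (ξ - η)]

theorem apply_mem_approxSubspace {P : VonNeumannAlgebra (EllTwo G)} {Λ : Subgroup G}
    {a : EllTwoOp G} (ha : a ∈ P) {ξ : EllTwo G} (hξ : ξ ∈ approxSubspace P Λ) :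
    a ξ ∈ approxSubspace P Λ := by
  intro ε hε
  obtain ⟨F, K, hF, hK, h⟩ := hξ (ε / (‖a‖ + 1)) (by positivity)
  refine ⟨F, K, hF, hK, fun b hb hb1 => ?_⟩
  have hpos : (0 : ℝ) < ‖a‖ + 1 := by positivity
  have := h (((‖a‖ + 1 : ℝ) : ℂ)⁻¹ • (b * a)) (P.toStarSubalgebra.smul_mem (mul_mem hb ha) _) (by
    rw [norm_smul, norm_inv, Complex.norm_real, Real.norm_of_nonneg hpos.le,
      inv_mul_le_iff₀ hpos, mul_one]
    refine (norm_mul_le _ _).trans ?_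
    nlinarith [norm_nonneg a])
  rw [smul_apply, map_smul, norm_smul, norm_inv, Complex.norm_real,
    Real.norm_of_nonneg hpos.le, inv_mul_le_iff₀ hpos] at this
  simpa [mul_div_cancel₀ _ hpos.ne'] using this

theorem rightRegular_mem_approxSubspace {P : VonNeumannAlgebra (EllTwo G)}
    (hP : P ≤ groupVN (⊤ : Subgroup G)) {Λ : Subgroup G}
    (g : G) {ξ : EllTwo G} (hξ : ξ ∈ approxSubspace P Λ) :
    rightRegular g ξ ∈ approxSubspace P Λ := by
  intro ε hε
  obtain ⟨F, K, hF, hK, h⟩ := hξ ε hε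
  refine ⟨F, K * {g⁻¹}, hF, hK.mul (Set.finite_singleton _), fun a ha ha1 => ?_⟩
  have h1 : a (rightRegular g ξ) = rightRegular g (a ξ) :=
    (congrArg (fun A : EllTwoOp G => A ξ) (mem_rightCommutant_iff_commute.mp
      (mem_groupVN_top_iff.mp (hP ha)) g trivial)).symm
  have h2 : restrict (F * (Λ : Set G) * (K * {g⁻¹}))ᶜ (rightRegular g (a ξ)) =
      rightRegular g (restrict (F * (Λ : Set G) * K)ᶜ (a ξ)) := by
    ext k
    have hk : k ∈ (F * (Λ : Set G) * (K * {g⁻¹}))ᶜ ↔ k * g ∈ (F * (Λ : Set G) * K)ᶜ := by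
      rw [← mul_assoc, Set.mul_singleton]
      simp
    rw [rightRegular_apply, restrict_apply, restrict_apply]
    by_cases hk' : k * g ∈ (F * (Λ : Set G) * K)ᶜ
    · rw [Set.indicator_of_mem hk', Set.indicator_of_mem (hk.mpr hk'), rightRegular_apply]
    · rw [Set.indicator_of_notMem hk', Set.indicator_of_notMem (fun hc => hk' (hk.mp hc))]
  rw [h1, h2, norm_rightRegular_apply]
  exact h a ha ha1

/-- The Fourier coefficients of an element of `L(Λ)` vanish outside `Λ`. -/
theorem restrict_apply_dirac_one_of_mem_groupVN {Λ : Subgroup G} {a : EllTwoOp G}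
    (ha : a ∈ groupVN Λ) : restrict (Λ : Set G) (a (dirac 1)) = a (dirac 1) := by
  set E := restrict (Λ : Set G)
  have hE : E ∈ StarSubalgebra.centralizer ℂ (leftRegular '' (Λ : Set G)) := by
    have hcomm : ∀ g ∈ Λ, leftRegular g * E = E * leftRegular g := by
      intro g hg
      ext ξ k
      have hk : g⁻¹ * k ∈ (Λ : Set G) ↔ k ∈ (Λ : Set G) :=
        Subgroup.mul_mem_cancel_left _ (Λ.inv_mem hg)
      change (Λ : Set G).indicator ξ (g⁻¹ * k) = (Λ : Set G).indicator (leftRegular g ξ) k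
      by_cases h : k ∈ (Λ : Set G)
      · rw [Set.indicator_of_mem h, Set.indicator_of_mem (hk.mpr h), leftRegular_apply]
      · rw [Set.indicator_of_notMem h, Set.indicator_of_notMem (fun h' => h (hk.mp h'))]
    refine (StarSubalgebra.mem_centralizer_iff ℂ).mpr ?_
    rintro _ ⟨g, hg, rfl⟩
    rw [star_leftRegular]
    exact ⟨hcomm g hg, hcomm _ (Λ.inv_mem hg)⟩
  have hcomm : E * a = a * E := ((StarSubalgebra.mem_centralizer_iff ℂ).mp ha E hE).1
  have := congrArg (fun A : EllTwoOp G => A (dirac 1)) hcomm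
  simpa [E, restrict_dirac_of_mem (show (1 : G) ∈ (Λ : Set G) from Λ.one_mem)] using this

/-- `L²(L(Λ))` is contained in `ℓ²(Λ)`. -/
theorem normCondExp_groupVN_le (Λ : Subgroup G) (x : EllTwoOp G) :
    normCondExp (groupVN Λ) x ≤ ‖restrict (Λ : Set G) (x (dirac 1))‖ := by
  set E := restrict (Λ : Set G)
  have hle : ∀ ξ ∈ ltwoSubspace (groupVN Λ), E ξ = ξ := by
    have hclosed : IsClosed {ξ : EllTwo G | E ξ = ξ} :=
      isClosed_eq E.continuous continuous_id
    have hsub : (Submodule.map (ContinuousLinearMap.apply ℂ (EllTwo G) (dirac (1 : G))).toLinearMap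
      (Subalgebra.toSubmodule (groupVN Λ).toStarSubalgebra.toSubalgebra) : Set (EllTwo G)) ⊆
        {ξ : EllTwo G | E ξ = ξ} := by
      rintro _ ⟨a, ha, rfl⟩
      exact restrict_apply_dirac_one_of_mem_groupVN ha
    intro ξ hξ
    exact closure_minimal hsub hclosed hξ
  set V := ltwoSubspace (groupVN Λ)
  set ξ := x (dirac 1)
  -- `E` fixes `V` and is self-adjoint, so it does not change inner products with vectors of `V`.
  have h : V.starProjection ξ = V.starProjection (E ξ) := by
    refine (Submodule.eq_starProjection_of_mem_orthogonal
      (Submodule.starProjection_apply_mem _ _) ?_).symm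
    rw [Submodule.mem_orthogonal]
    intro η hη
    have h1 := (Submodule.mem_orthogonal _ _).mp (Submodule.sub_starProjection_mem_orthogonal
      (K := V) ξ) η hη
    have h2 : inner ℂ η (E ξ) = inner ℂ η ξ := by
      rw [← ContinuousLinearMap.adjoint_inner_left, ← ContinuousLinearMap.star_eq_adjoint,
        star_restrict, hle η hη]
    rw [inner_sub_right] at h1 ⊢
    rw [h2, h1]
  change ‖V.starProjection ξ‖ ≤ _
  rw [h]
  exact V.norm_starProjection_apply_le _

end Approximation

section Corner

variable {G : Type*} {P : VonNeumannAlgebra (EllTwo G)} {p u w : EllTwoOp G}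

theorem mul_left_of_mem_cornerUnitaries (hp : IsStarProjection p) (hpP : p ∈ P.commutant)
    (hu : u ∈ cornerUnitaries P p) : p * u = u := by
  obtain ⟨⟨a, ha, rfl⟩, -⟩ := hu
  rw [← mul_assoc, ← VonNeumannAlgebra.mem_commutant_iff.mp hpP a ha, mul_assoc,
    hp.isIdempotentElem.eq]

theorem mul_right_of_mem_cornerUnitaries (hp : IsStarProjection p)
    (hu : u ∈ cornerUnitaries P p) : u * p = u := by
  obtain ⟨⟨a, ha, rfl⟩, -⟩ := hu
  rw [mul_assoc, hp.isIdempotentElem.eq]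

theorem mul_mem_cornerUnitaries (hp : IsStarProjection p) (hpP : p ∈ P.commutant)
    (hu : u ∈ cornerUnitaries P p) (hw : w ∈ cornerUnitaries P p) :
    u * w ∈ cornerUnitaries P p := by
  have hpw := mul_left_of_mem_cornerUnitaries hp hpP hw
  have hup := mul_right_of_mem_cornerUnitaries hp hu
  obtain ⟨⟨a, ha, hua⟩, hu1, hu2⟩ := hu
  obtain ⟨⟨b, hb, hwb⟩, hw1, hw2⟩ := hw
  refine ⟨⟨a * b, mul_mem ha hb, ?_⟩, ?_, ?_⟩
  · rw [hua, mul_assoc, hpw, hwb, mul_assoc]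
  · calc star (u * w) * (u * w) = star w * (star u * u) * w := by rw [star_mul]; noncomm_ring
      _ = p := by rw [hu1, mul_assoc, hpw, hw1]
  · calc u * w * star (u * w) = u * (w * star w) * star u := by rw [star_mul]; noncomm_ring
      _ = p := by rw [hw2, hup, hu2]

theorem self_mem_cornerUnitaries (hp : IsStarProjection p) : p ∈ cornerUnitaries P p := by
  refine ⟨⟨1, one_mem P, (one_mul p).symm⟩, ?_, ?_⟩ <;>
    rw [hp.isSelfAdjoint.star_eq, hp.isIdempotentElem.eq]

theorem mul_unitary_mem_cornerUnitaries (hp : IsStarProjection p) (hpP : p ∈ P.commutant)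
    (hw : w ∈ P) (hwu : w ∈ unitary (EllTwoOp G)) : w * p ∈ cornerUnitaries P p := by
  have hcomm := VonNeumannAlgebra.mem_commutant_iff.mp hpP w hw
  refine ⟨⟨w, hw, rfl⟩, ?_, ?_⟩
  · calc star (w * p) * (w * p) = p * (star w * w) * p := by
          rw [star_mul, hp.isSelfAdjoint.star_eq]; noncomm_ring
      _ = p := by rw [(Unitary.mem_iff.mp hwu).1, mul_one, hp.isIdempotentElem.eq]
  · calc w * p * star (w * p) = (w * p) * p * star w := by
          rw [star_mul, hp.isSelfAdjoint.star_eq]; noncomm_ring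
      _ = p * (w * star w) := by
          rw [mul_assoc w p p, hp.isIdempotentElem.eq, hcomm, mul_assoc]
      _ = p := by rw [(Unitary.mem_iff.mp hwu).2, mul_one]

theorem norm_le_one_of_mem_cornerUnitaries (hp : IsStarProjection p)
    (hu : u ∈ cornerUnitaries P p) : ‖u‖ ≤ 1 := by
  have h1 : ‖u‖ * ‖u‖ = ‖p‖ := by
    rw [← hu.2.1]
    exact (CStarRing.norm_star_mul_self (x := u)).symm
  have h2 : ‖p‖ ≤ 1 := hp.norm_le
  nlinarith [norm_nonneg u]

theorem norm_le_one_of_mem_unitary (hw : w ∈ unitary (EllTwoOp G)) : ‖w‖ ≤ 1 := by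
  have h1 : ‖w‖ * ‖w‖ = ‖(1 : EllTwoOp G)‖ := by
    rw [← (Unitary.mem_iff.mp hw).1]
    exact (CStarRing.norm_star_mul_self (x := w)).symm
  have h2 : ‖(1 : EllTwoOp G)‖ ≤ 1 := ContinuousLinearMap.norm_id_le
  nlinarith [norm_nonneg w]

end Corner

section Intertwining

variable {G : Type*} [Group G]

theorem hsSq_sum_ne_top (Λ : Subgroup G) {ι : Type*} (s : Finset ι) {T : ι → EllTwoOp G}
    (h : ∀ i ∈ s, hsSq Λ (T i) ≠ ∞) : hsSq Λ (∑ i ∈ s, T i) ≠ ∞ := by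
  refine Finset.sum_induction T (fun A => hsSq Λ A ≠ ∞) ?_ ?_ h
  · intro A B hA hB
    exact ne_top_of_le_ne_top (by finiteness) (hsSq_add_le Λ A B)
  · simp [hsSq]

theorem enorm_apply_apply_dirac_sq_le {Λ : Subgroup G} {T y : EllTwoOp G}
    (hT : T ∈ rightCommutant Λ) (hy : y ∈ rightCommutant (⊤ : Subgroup G)) (g : G) :
    ‖T (y (dirac g))‖ₑ ^ 2 ≤ ‖y‖ₑ ^ 2 * hsSq Λ T := by
  have hy' := rightCommutant_anti (le_top (a := Λ)) hy
  exact (enorm_apply_dirac_sq_le (mul_mem hT hy') g).trans (hsSq_mul_right hy' hT)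

theorem norm_le_of_enorm_sq_le {E : Type*} [SeminormedAddCommGroup E] {v : E} {r : ℝ}
    (hr : 0 ≤ r) (h : ‖v‖ₑ ^ 2 ≤ ENNReal.ofReal r ^ 2) : ‖v‖ ≤ r := by
  rw [ENNReal.pow_le_pow_left_iff two_ne_zero, ← ofReal_norm] at h
  exact (ENNReal.ofReal_le_ofReal_iff hr).mp h

/-- If `P p` intertwines into `L(Λ)`, then some nonzero vector in the range of `p` has a uniformly
concentrated orbit under the unit ball of `P`. -/
theorem exists_mem_approxSubspace {P : VonNeumannAlgebra (EllTwo G)}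
    (hP : P ≤ groupVN (⊤ : Subgroup G)) {Λ : Subgroup G} {p : EllTwoOp G}
    (hp : IsStarProjection p) (hpP : p ∈ P.commutant) (hpM : p ∈ groupVN (⊤ : Subgroup G))
    (hint : CornerIntertwines P p (groupVN Λ)) :
    ∃ ξ ∈ approxSubspace P Λ, ξ ≠ 0 ∧ p ξ = ξ := by
  obtain ⟨m, x, y, C, hx, hy, hC, hu⟩ := hint
  have hx' := fun i => rightCommutant_anti (le_top (a := Λ)) (mem_groupVN_top_iff.mp (hx i))
  have hy' := fun i => mem_groupVN_top_iff.mp (hy i)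
  have hpΛ := rightCommutant_anti (le_top (a := Λ)) (mem_groupVN_top_iff.mp hpM)
  have huΛ : ∀ u ∈ cornerUnitaries P p, u ∈ rightCommutant Λ := by
    rintro u ⟨⟨a, ha, rfl⟩, -⟩
    exact mul_mem (rightCommutant_anti le_top (mem_groupVN_top_iff.mp (hP ha))) hpΛ
  have hunorm : ∀ u ∈ cornerUnitaries P p, ‖u‖ₑ ^ 2 ≤ 1 := by
    intro u hu'
    refine pow_le_one₀ zero_le ?_
    rw [← ofReal_norm]
    exact ENNReal.ofReal_le_one.mpr (norm_le_one_of_mem_cornerUnitaries hp hu')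
  set E : EllTwoOp G := restrict (Λ : Set G) with hE
  have hEΛ : E ∈ rightCommutant Λ :=
    restrict_mem_rightCommutant fun a g hg => Subgroup.mul_mem_cancel_right _ hg
  set η : Fin m → EllTwo G := fun i => y i (dirac 1) with hη
  set D : EllTwoOp G := ∑ i, star (x i) * (E * x i) with hD
  -- The positive functional that the intertwining condition bounds from below.
  set φ : EllTwoOp G → ℝ := fun T => ∑ i, (inner ℂ (η i) (T (η i))).re with hφ
  have hφD : ∀ u ∈ cornerUnitaries P p, C ≤ φ (star u * D * u) := by
    intro u hu'
    refine (hu u hu').trans (Finset.sum_le_sum fun i _ => ?_)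
    have hE2 : ∀ ζ : EllTwo G, (inner ℂ ζ (E ζ)).re = ‖E ζ‖ ^ 2 := by
      intro ζ
      have h1 : E ζ = star E (E ζ) := by
        rw [hE, star_restrict, ← mul_apply_eq_comp, restrict_mul_self]
      rw [h1, ContinuousLinearMap.star_eq_adjoint, ContinuousLinearMap.adjoint_inner_right,
        ← ContinuousLinearMap.star_eq_adjoint, ← h1, inner_self_eq_norm_sq_to_K]
      norm_cast
    have h2 : (inner ℂ (η i) ((star u * D * u) (η i))).re =
        ∑ l, ‖E (x l (u (η i)))‖ ^ 2 := by
      have : (star u * D * u) (η i) = star u (D (u (η i))) := rfl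
      rw [this, ContinuousLinearMap.star_eq_adjoint, ContinuousLinearMap.adjoint_inner_right, hD,
        sum_apply, inner_sum, Complex.re_sum]
      refine Finset.sum_congr rfl fun l _ => ?_
      have : (star (x l) * (E * x l)) (u (η i)) = star (x l) (E (x l (u (η i)))) := rfl
      rw [this, ContinuousLinearMap.star_eq_adjoint, ContinuousLinearMap.adjoint_inner_right, hE2]
    rw [h2]
    calc normCondExp (groupVN Λ) (x i * u * y i) ^ 2
        ≤ ‖E (x i (u (η i)))‖ ^ 2 :=
          pow_le_pow_left₀ (norm_nonneg _) (normCondExp_groupVN_le Λ _) 2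
      _ ≤ ∑ l, ‖E (x l (u (η i)))‖ ^ 2 :=
          Finset.single_le_sum (f := fun l => ‖E (x l (u (η i)))‖ ^ 2)
            (fun l _ => by positivity) (Finset.mem_univ i)
  -- `K` is stable under midpoints and under conjugation by `𝒰(P p)`, and minimizing the
  -- Hilbert-Schmidt norm on it yields operators that are almost invariant under this conjugation.
  -- The lower bound on `φ` keeps them away from `0`.
  set K : Set (EllTwoOp G) := {T | T ∈ rightCommutant Λ ∧ hsSq Λ T ≠ ∞ ∧ p * T = T ∧ T * p = T ∧
    ∀ u ∈ cornerUnitaries P p, C ≤ φ (star u * T * u)} with hK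
  have hDΛ : D ∈ rightCommutant Λ :=
    sum_mem fun i _ => mul_mem (star_mem (hx' i)) (mul_mem hEΛ (hx' i))
  have hDfin : hsSq Λ D ≠ ∞ := by
    refine hsSq_sum_ne_top Λ _ fun i _ => ?_
    refine ne_top_of_le_ne_top ?_ (hsSq_mul_left _ _ _)
    refine ENNReal.mul_ne_top (by finiteness) (ne_top_of_le_ne_top ?_ (hsSq_mul_right (hx' i) hEΛ))
    exact ENNReal.mul_ne_top (by finiteness)
      (ne_top_of_le_ne_top ENNReal.one_ne_top (hsSq_restrict_le Λ))
  have hKne : K.Nonempty := by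
    refine ⟨p * D * p, mul_mem (mul_mem hpΛ hDΛ) hpΛ, ?_, ?_, ?_, fun u hu' => ?_⟩
    · refine ne_top_of_le_ne_top ?_ (hsSq_mul_right hpΛ (mul_mem hpΛ hDΛ))
      exact ENNReal.mul_ne_top (by finiteness) (ne_top_of_le_ne_top
        (ENNReal.mul_ne_top (by finiteness) hDfin) (hsSq_mul_left _ _ _))
    · rw [← mul_assoc, ← mul_assoc, hp.isIdempotentElem.eq]
    · rw [mul_assoc, hp.isIdempotentElem.eq]
    · have h1 := mul_left_of_mem_cornerUnitaries hp hpP hu'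
      have h2 : star u * p = star u := by
        rw [← hp.isSelfAdjoint.star_eq, ← star_mul, h1]
      have h3 : star u * (p * D * p) * u = star u * D * u := by
        calc star u * (p * D * p) * u = (star u * p) * D * (p * u) := by noncomm_ring
          _ = _ := by rw [h1, h2]
      rw [h3]
      exact hφD u hu'
  have hKmid : ∀ A ∈ K, ∀ B ∈ K, (2⁻¹ : ℂ) • (A + B) ∈ K := by
    rintro A ⟨hA1, hA2, hA3, hA4, hA5⟩ B ⟨hB1, hB2, hB3, hB4, hB5⟩
    refine ⟨(rightCommutant Λ).smul_mem (add_mem hA1 hB1) _, ?_, ?_, ?_, fun u hu' => ?_⟩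
    · rw [hsSq_smul]
      exact ENNReal.mul_ne_top (by finiteness)
        (ne_top_of_le_ne_top (by finiteness) (hsSq_add_le Λ A B))
    · rw [mul_smul_comm, mul_add, hA3, hB3]
    · rw [smul_mul_assoc, add_mul, hA4, hB4]
    · have h1 : φ (star u * ((2⁻¹ : ℂ) • (A + B)) * u) =
          2⁻¹ * (φ (star u * A * u) + φ (star u * B * u)) := by
        have h2 : star u * ((2⁻¹ : ℂ) • (A + B)) * u =
            (2⁻¹ : ℂ) • (star u * A * u + star u * B * u) := by
          rw [mul_smul_comm, smul_mul_assoc, mul_add, add_mul]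
        have h3 : ∀ z : ℂ, ((2⁻¹ : ℂ) * z).re = 2⁻¹ * z.re := by
          intro z
          rw [show (2⁻¹ : ℂ) = ((2⁻¹ : ℝ) : ℂ) by norm_num, Complex.re_ofReal_mul]
        rw [h2, hφ]
        simp only [smul_apply, add_apply, inner_smul_right, inner_add_right, h3, Complex.add_re]
        rw [← Finset.sum_add_distrib, Finset.mul_sum]
      rw [h1]
      linarith [hA5 u hu', hB5 u hu']
  have hKconj : ∀ T ∈ K, ∀ u ∈ cornerUnitaries P p, star u * T * u ∈ K ∧
      hsSq Λ (star u * T * u) ≤ hsSq Λ T := by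
    rintro T ⟨hT1, hT2, hT3, hT4, hT5⟩ u hu'
    have hle : hsSq Λ (star u * T * u) ≤ hsSq Λ T := by
      calc hsSq Λ (star u * T * u) ≤ ‖u‖ₑ ^ 2 * hsSq Λ (star u * T) :=
            hsSq_mul_right (huΛ u hu') (mul_mem (star_mem (huΛ u hu')) hT1)
        _ ≤ 1 * (‖star u‖ₑ ^ 2 * hsSq Λ T) := by
            gcongr
            · exact hunorm u hu'
            · exact hsSq_mul_left _ _ _
        _ ≤ 1 * (1 * hsSq Λ T) := by
            gcongr
            rw [← ofReal_norm, norm_star_op, ofReal_norm]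
            exact hunorm u hu'
        _ = hsSq Λ T := by rw [one_mul, one_mul]
    have h1 := mul_left_of_mem_cornerUnitaries hp hpP hu'
    have h2 := mul_right_of_mem_cornerUnitaries hp hu'
    have h3 : p * star u = star u := by
      rw [← hp.isSelfAdjoint.star_eq, ← star_mul, h2]
    refine ⟨⟨mul_mem (mul_mem (star_mem (huΛ u hu')) hT1) (huΛ u hu'),
      ne_top_of_le_ne_top hT2 hle, ?_, ?_, fun w hw => ?_⟩, hle⟩
    · rw [← mul_assoc, ← mul_assoc, h3]
    · rw [mul_assoc, h2]
    · have h4 : star w * (star u * T * u) * w = star (u * w) * T * (u * w) := by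
        rw [star_mul]; noncomm_ring
      rw [h4]
      exact hT5 _ (mul_mem_cornerUnitaries hp hpP hu' hw)
  obtain ⟨T, hTK, hT⟩ := exists_minimizing_seq Λ hKne (fun T hT => hT.2.1) hKmid
  -- Smallness in Hilbert-Schmidt norm controls the vectors `A (w (η i))` for contractions `w`.
  have hsmall : ∀ i, ∀ ε : ℝ, 0 < ε → ∃ δ : ℝ≥0∞, 0 < δ ∧ ∀ A ∈ rightCommutant Λ,
      hsSq Λ A ≤ δ → ∀ w ∈ P, ‖w‖ ≤ 1 → ‖A (w (η i))‖ ≤ ε := by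
    intro i ε hε
    have hne : ‖y i‖ₑ ^ 2 + 1 ≠ ∞ := by finiteness
    refine ⟨ENNReal.ofReal ε ^ 2 / (‖y i‖ₑ ^ 2 + 1),
      ENNReal.div_pos (by simpa using hε) hne, fun A hA hAδ w hw hw1 => ?_⟩
    refine norm_le_of_enorm_sq_le hε.le ?_
    have hwy : w * y i ∈ rightCommutant (⊤ : Subgroup G) :=
      mul_mem (mem_groupVN_top_iff.mp (hP hw)) (hy' i)
    refine (enorm_apply_apply_dirac_sq_le hA hwy 1).trans ?_
    have h1 : ‖w * y i‖ₑ ≤ ‖y i‖ₑ := by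
      rw [← ofReal_norm, ← ofReal_norm]
      refine ENNReal.ofReal_le_ofReal ((norm_mul_le _ _).trans ?_)
      nlinarith [norm_nonneg (y i)]
    calc ‖w * y i‖ₑ ^ 2 * hsSq Λ A
        ≤ (‖y i‖ₑ ^ 2 + 1) * (ENNReal.ofReal ε ^ 2 / (‖y i‖ₑ ^ 2 + 1)) := by
          gcongr
          exact le_self_add.trans' (by gcongr)
      _ = ENNReal.ofReal ε ^ 2 := ENNReal.mul_div_cancel (by simp) hne
  have hcauchy : ∀ i, CauchySeq fun n => T n (η i) := by
    intro i
    refine Metric.cauchySeq_iff'.mpr fun ε hε => ?_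
    obtain ⟨δ, hδ, h⟩ := hsmall i (ε / 2) (by positivity)
    obtain ⟨N, hN⟩ := hT δ hδ
    refine ⟨N, fun n hn => ?_⟩
    have := h (T n - T N) (sub_mem (hTK n).1 (hTK N).1) ((hN n hn).2 N le_rfl) 1 (one_mem P)
      ContinuousLinearMap.norm_id_le
    rw [dist_eq_norm]
    refine lt_of_le_of_lt this (by linarith)
  choose ξ hξ using fun i => cauchySeq_tendsto_of_complete (hcauchy i)
  have hsum : C ≤ ∑ i, (inner ℂ (η i) (ξ i)).re := by
    have hlim : Tendsto (fun n => ∑ i, (inner ℂ (η i) (T n (η i))).re) atTop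
        (𝓝 (∑ i, (inner ℂ (η i) (ξ i)).re)) :=
      tendsto_finsetSum _ fun i _ =>
        (Complex.continuous_re.tendsto _).comp (tendsto_const_nhds.inner (hξ i))
    refine ge_of_tendsto' hlim fun n => ?_
    have h1 := (hTK n).2.2.2.2 p (self_mem_cornerUnitaries hp)
    rwa [hp.isSelfAdjoint.star_eq, (hTK n).2.2.1, (hTK n).2.2.2.1] at h1
  obtain ⟨i, hi⟩ : ∃ i, ξ i ≠ 0 := by
    by_contra! hcon
    simp [hcon] at hsum
    linarith
  refine ⟨ξ i, ?_, hi, ?_⟩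
  · rw [mem_approxSubspace]
    intro ε hε
    obtain ⟨δ, hδ, hδ'⟩ := hsmall i (ε / 6) (by positivity)
    obtain ⟨N, hN⟩ := hT δ hδ
    obtain ⟨N', hN'⟩ := Metric.tendsto_atTop.mp (hξ i) (ε / 6) (by positivity)
    set n := max N N'
    obtain ⟨F, hF, hFδ, hFΛ⟩ := exists_finite_hsSq_restrict_le (hTK n).1 (hTK n).2.1 hδ
    refine ⟨F, {1}, hF, Set.finite_singleton _, fun a ha ha1 => ?_⟩
    have h2 : (F * (Λ : Set G) * {1} : Set G) = F * (Λ : Set G) := by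
      rw [Set.mul_singleton]; simp
    rw [h2]
    set B : EllTwoOp G := restrict (F * (Λ : Set G))ᶜ with hB
    have hunit : ∀ w ∈ P, w ∈ unitary (EllTwoOp G) → ‖B (w (ξ i))‖ ≤ ε / 2 := by
      intro w hw hwu
      have hw1 : ‖w‖ ≤ 1 := norm_le_one_of_mem_unitary hwu
      have hcorner := mul_unitary_mem_cornerUnitaries hp hpP hw hwu
      have hcomm := VonNeumannAlgebra.mem_commutant_iff.mp hpP w hw
      have hwΛ := rightCommutant_anti (le_top (a := Λ)) (mem_groupVN_top_iff.mp (hP hw))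
      obtain ⟨hT1, hT2, hT3, hT4, hT5⟩ := hTK n
      obtain ⟨hc1, hc2⟩ := hKconj _ (hTK n) _ hcorner
      -- Almost invariance under conjugation by `w p` means that `w` almost commutes with `T n`.
      have hid : w * T n - T n * w =
          (w * p) * (T n - star (w * p) * T n * (w * p)) := by
        calc w * T n - T n * w
            = w * (p * T n) - p * T n * p * w := by rw [hT3, hT4]
          _ = (w * p) * T n - p * (T n * (w * p)) := by
              rw [← mul_assoc w p, hcomm]; simp only [mul_assoc]
          _ = (w * p) * T n - (w * p) * star (w * p) * (T n * (w * p)) := by rw [hcorner.2.2]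
          _ = _ := by simp only [mul_sub, mul_assoc]
      have hcommsmall : hsSq Λ (w * T n - T n * w) ≤ δ := by
        rw [hid]
        refine (hsSq_mul_left _ _ _).trans ?_
        calc ‖w * p‖ₑ ^ 2 * hsSq Λ (T n - star (w * p) * T n * (w * p)) ≤ 1 * δ := by
              gcongr
              · exact hunorm _ hcorner
              · exact (hN n (le_max_left _ _)).1 _ hc1 hc2
          _ = δ := one_mul δ
      have e1 : ‖B (w (ξ i - T n (η i)))‖ ≤ ε / 6 := by
        refine (norm_restrict_le _ _).trans ((w.le_opNorm _).trans ?_)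
        have := (hN' n (le_max_right _ _)).le
        rw [dist_comm, dist_eq_norm] at this
        nlinarith [norm_nonneg (ξ i - T n (η i))]
      have e2 : ‖B ((w * T n - T n * w) (η i))‖ ≤ ε / 6 :=
        (norm_restrict_le _ _).trans (hδ' _ (sub_mem (mul_mem hwΛ hT1) (mul_mem hT1 hwΛ))
          hcommsmall 1 (one_mem P) ContinuousLinearMap.norm_id_le)
      have e3 : ‖(B * T n) (w (η i))‖ ≤ ε / 6 :=
        hδ' _ (mul_mem hFΛ hT1) hFδ w hw hw1
      have hsplit : B (w (ξ i)) = B (w (ξ i - T n (η i))) + B ((w * T n - T n * w) (η i)) +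
          (B * T n) (w (η i)) := by
        simp only [sub_apply, mul_apply_eq_comp, map_sub]
        abel
      rw [hsplit]
      refine (norm_add₃_le).trans ?_
      linarith
    refine (norm_apply_le_of_unitary P B (ξ i) hunit ha ha1).trans_eq ?_
    ring
  · refine tendsto_nhds_unique ((p.continuous.tendsto _).comp (hξ i)) ?_
    refine (hξ i).congr fun n => ?_
    change T n (η i) = (p * T n) (η i)
    rw [(hTK n).2.2.1]

/-- Strong intertwining into `L(Λ)` amounts to approximate containment: the unit ball of `P` is, up
to `ε` in the 2-norm, supported on a single set `F Λ K` with `F` and `K` finite. -/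
theorem StronglyIntertwines.exists_finite_approx {P : VonNeumannAlgebra (EllTwo G)}
    (hP : P ≤ groupVN (⊤ : Subgroup G)) {Λ : Subgroup G}
    (h : StronglyIntertwines P (groupVN Λ)) {ε : ℝ} (hε : 0 < ε) :
    ∃ F K : Set G, F.Finite ∧ K.Finite ∧
      ∀ a ∈ P, ‖a‖ ≤ 1 → ‖restrict (F * (Λ : Set G) * K)ᶜ (a (dirac 1))‖ ≤ ε := by
  set V := approxSubspace P Λ with hV
  have : CompleteSpace V := (isClosed_approxSubspace P Λ).completeSpace_coe
  set q : EllTwoOp G := V.starProjection with hq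
  have hqstar : IsStarProjection q := isStarProjection_starProjection
  have hqP : q ∈ P.commutant := VonNeumannAlgebra.mem_commutant_iff.mpr fun a ha =>
    (starProjection_commute V (fun ξ hξ => apply_mem_approxSubspace ha hξ)
      (fun ξ hξ => apply_mem_approxSubspace (star_mem ha) hξ)).symm
  have hqM : q ∈ groupVN (⊤ : Subgroup G) := by
    rw [mem_groupVN_top_iff, mem_rightCommutant_iff_commute]
    intro g _
    refine (starProjection_commute V (fun ξ hξ => rightRegular_mem_approxSubspace hP g hξ)
      fun ξ hξ => ?_).symm
    rw [star_rightRegular]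
    exact rightRegular_mem_approxSubspace hP _ hξ
  have hq1 : 1 - q = 0 := by
    by_contra hne
    have hpP : 1 - q ∈ P.commutant := sub_mem (one_mem _) hqP
    have hpM : 1 - q ∈ groupVN (⊤ : Subgroup G) := sub_mem (one_mem _) hqM
    obtain ⟨ξ, hξV, hξ0, hξ⟩ := exists_mem_approxSubspace hP hqstar.one_sub hpP hpM
      (h _ hqstar.one_sub hne hpP hpM)
    refine hξ0 ?_
    rw [← hξ, sub_apply, one_apply_eq_self, hq, Submodule.starProjection_eq_self_iff.mpr hξV,
      sub_self]
  have hmem : dirac 1 ∈ V := by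
    rw [← Submodule.starProjection_eq_self_iff, ← hq, ← sub_eq_zero.mp hq1]
    rfl
  exact hmem ε hε

end Intertwining

/-! ### Fourier coefficients and bounded truncations -/

section Fourier

theorem tsum_enorm_blockDiagonal_le {G X : Type*} (f : G → X) (a : EllTwoOp G) (ξ : EllTwo G) :
    ∑' h, ‖a (restrict {x | f x = f h} ξ) h‖ₑ ^ 2 ≤ ‖a‖ₑ ^ 2 * ‖ξ‖ₑ ^ 2 := by
  rw [enorm_sq_eq_tsum ξ, ← (Equiv.sigmaFiberEquiv f).tsum_eq,
    ← (Equiv.sigmaFiberEquiv f).tsum_eq (fun g => ‖ξ g‖ₑ ^ 2), ENNReal.tsum_sigma',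
    ENNReal.tsum_sigma', ← ENNReal.tsum_mul_left]
  refine ENNReal.tsum_le_tsum fun c => ?_
  set η := restrict {x | f x = c} ξ with hη
  have h1 : ∑' h : {x // f x = c}, ‖ξ h‖ₑ ^ 2 = ‖η‖ₑ ^ 2 := by
    rw [enorm_sq_eq_tsum, ← tsum_subtype_eq_of_support_subset (s := {x | f x = c})]
    · refine tsum_congr fun h => ?_
      have : η h = ξ h := restrict_apply_of_mem (A := {x | f x = c}) h.2 ξ
      rw [this]
    · intro h hh
      by_contra hc
      exact hh (by simp [hη, restrict_apply_of_notMem hc])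
  have h2 : ∑' h : {x // f x = c}, ‖a (restrict {x | f x = f h} ξ) h‖ₑ ^ 2 ≤ ‖a η‖ₑ ^ 2 := by
    rw [enorm_sq_eq_tsum]
    refine le_trans (le_of_eq (tsum_congr fun h => ?_))
      (ENNReal.tsum_comp_le_tsum_of_injective Subtype.val_injective (fun h => ‖a η h‖ₑ ^ 2))
    rw [h.2]
  change ∑' h : {x // f x = c}, ‖a (restrict {x | f x = f h} ξ) h‖ₑ ^ 2 ≤
    ‖a‖ₑ ^ 2 * ∑' h : {x // f x = c}, ‖ξ h‖ₑ ^ 2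
  rw [h1]
  refine h2.trans ?_
  rw [← mul_pow]
  gcongr
  exact a.le_opENorm η

/-- The compression of `a` to the block diagonal for the partition of `G` into the fibers of
`f`. -/
def blockDiagonal {G X : Type*} (f : G → X) (a : EllTwoOp G) : EllTwoOp G :=
  LinearMap.mkContinuous
    { toFun := fun ξ => ⟨fun h => a (restrict {x | f x = f h} ξ) h,
        memℓp_two_of_tsum_ne_top
          (ne_top_of_le_ne_top (by finiteness) (tsum_enorm_blockDiagonal_le f a ξ))⟩
      map_add' := fun ξ η => by
        ext h
        simp
        rfl
      map_smul' := fun c ξ => by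
        ext h
        simp } ‖a‖ (fun ξ => by
    refine norm_le_of_enorm_sq_le (by positivity) ?_
    rw [ENNReal.ofReal_mul (norm_nonneg _), ofReal_norm, ofReal_norm, mul_pow, enorm_sq_eq_tsum]
    exact tsum_enorm_blockDiagonal_le f a ξ)

theorem blockDiagonal_apply {G X : Type*} (f : G → X) (a : EllTwoOp G) (ξ : EllTwo G) (h : G) :
    blockDiagonal f a ξ h = a (restrict {x | f x = f h} ξ) h := rfl

theorem norm_blockDiagonal_le {G X : Type*} (f : G → X) (a : EllTwoOp G) :
    ‖blockDiagonal f a‖ ≤ ‖a‖ :=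
  LinearMap.mkContinuous_norm_le _ (norm_nonneg a) _

variable {G : Type*} [Group G]

/-- The Fourier coefficient `τ(a u_g*)`. -/
def groupCoeff (a : EllTwoOp G) (g : G) : ℂ := a (dirac 1) g

theorem norm_groupCoeff_le (a : EllTwoOp G) (g : G) : ‖groupCoeff a g‖ ≤ ‖a‖ := by
  refine (norm_apply_le _ _).trans ((a.le_opNorm _).trans_eq ?_)
  rw [norm_dirac, mul_one]

theorem groupCoeff_sub (a b : EllTwoOp G) (g : G) :
    groupCoeff (a - b) g = groupCoeff a g - groupCoeff b g := rfl

theorem tsum_enorm_groupCoeff_sq_le (a : EllTwoOp G) :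
    ∑' g, ‖groupCoeff a g‖ₑ ^ 2 ≤ ‖a‖ₑ ^ 2 := by
  have h := enorm_sq_eq_tsum (a (dirac 1))
  have h1 : ‖a (dirac 1)‖ₑ ≤ ‖a‖ₑ := by
    rw [← ofReal_norm, ← ofReal_norm]
    refine ENNReal.ofReal_le_ofReal ((a.le_opNorm _).trans_eq ?_)
    rw [norm_dirac, mul_one]
  calc ∑' g, ‖groupCoeff a g‖ₑ ^ 2 = ‖a (dirac 1)‖ₑ ^ 2 := h.symm
    _ ≤ ‖a‖ₑ ^ 2 := by gcongr

theorem hasSum_groupCoeff_mul {a : EllTwoOp G} (ha : a ∈ rightCommutant (⊤ : Subgroup G))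
    (b : EllTwoOp G) (s : G) :
    HasSum (fun r => groupCoeff b r * groupCoeff a (s * r⁻¹)) (groupCoeff (a * b) s) := by
  have h := hasSum_matrix a (b (dirac 1)) s
  simpa only [apply_dirac_eq ha _ s] using! h

theorem groupCoeff_one (g : G) : groupCoeff (1 : EllTwoOp G) g = dirac 1 g := rfl

/-- The 2-norm of `L(G)` is invariant under the adjoint. -/
theorem norm_star_apply_dirac_one {a : EllTwoOp G}
    (ha : a ∈ rightCommutant (⊤ : Subgroup G)) : ‖star a (dirac 1)‖ = ‖a (dirac 1)‖ := by
  rw [← toReal_enorm, ← toReal_enorm]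
  congr 1
  refine (ENNReal.pow_right_strictMono two_ne_zero).injective ?_
  change ‖star a (dirac 1)‖ₑ ^ 2 = ‖a (dirac 1)‖ₑ ^ 2
  rw [enorm_sq_eq_tsum, enorm_sq_eq_tsum, ← (Equiv.inv G).tsum_eq]
  refine tsum_congr fun g => ?_
  rw [Equiv.inv_apply, star_apply_dirac, apply_dirac_eq ha, one_mul, inv_inv, ← ofReal_norm,
    norm_star, ofReal_norm]

theorem norm_mul_apply_dirac_one_le {a b : EllTwoOp G}
    (ha : a ∈ rightCommutant (⊤ : Subgroup G)) (hb : b ∈ rightCommutant (⊤ : Subgroup G)) :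
    ‖(a * b) (dirac 1)‖ ≤ ‖a (dirac 1)‖ * ‖b‖ := by
  rw [← norm_star_apply_dirac_one (mul_mem ha hb), star_mul, ← norm_star_apply_dirac_one ha,
    mul_comm, ← norm_star_op b]
  exact (star b).le_opNorm _

/-- Restricting Fourier coefficients to `A` maps `L(G)` to itself and is bounded by `C` in the
operator norm. -/
def IsMultiplier (C : ℝ) (A : Set G) : Prop :=
  0 ≤ C ∧ ∀ a ∈ rightCommutant (⊤ : Subgroup G), ∃ b ∈ rightCommutant (⊤ : Subgroup G),
    ‖b‖ ≤ C * ‖a‖ ∧ ∀ g, groupCoeff b g = A.indicator (groupCoeff a) g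

theorem IsMultiplier.compl {C : ℝ} {A : Set G} (h : IsMultiplier C A) :
    IsMultiplier (1 + C) Aᶜ := by
  refine ⟨by linarith [h.1], fun a ha => ?_⟩
  obtain ⟨b, hb, hbn, hbf⟩ := h.2 a ha
  refine ⟨a - b, sub_mem ha hb, (norm_sub_le _ _).trans (by linarith), fun g => ?_⟩
  rw [groupCoeff_sub, hbf]
  by_cases hg : g ∈ A <;> simp [hg]

theorem IsMultiplier.inter {C C' : ℝ} {A B : Set G} (hA : IsMultiplier C A)
    (hB : IsMultiplier C' B) : IsMultiplier (C' * C) (A ∩ B) := by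
  refine ⟨mul_nonneg hB.1 hA.1, fun a ha => ?_⟩
  obtain ⟨b, hb, hbn, hbf⟩ := hA.2 a ha
  obtain ⟨c, hc, hcn, hcf⟩ := hB.2 b hb
  refine ⟨c, hc, hcn.trans ?_, fun g => ?_⟩
  · rw [mul_assoc]
    exact mul_le_mul_of_nonneg_left hbn hB.1
  · rw [hcf]
    by_cases hgB : g ∈ B
    · rw [Set.indicator_of_mem hgB, hbf]
      by_cases hgA : g ∈ A <;> simp [hgA, hgB]
    · simp [hgB]

theorem IsMultiplier.union {C C' : ℝ} {A B : Set G} (hA : IsMultiplier C A)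
    (hB : IsMultiplier C' B) : ∃ C'', IsMultiplier C'' (A ∪ B) := by
  have := (hA.compl.inter hB.compl).compl
  rw [Set.compl_inter, compl_compl, compl_compl] at this
  exact ⟨_, this⟩

theorem isMultiplier_empty : IsMultiplier 0 (∅ : Set G) :=
  ⟨le_rfl, fun a _ => ⟨0, zero_mem _, by simp, fun g => by simp [groupCoeff]⟩⟩

/-- The conditional expectation onto `L(Λ)`: compress to the block diagonal for the partition into
right cosets of `Λ`. -/
theorem isMultiplier_subgroup (Λ : Subgroup G) : IsMultiplier 1 (Λ : Set G) := by
  refine ⟨zero_le_one, fun a ha => ?_⟩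
  set f : G → Quotient (QuotientGroup.rightRel Λ) := fun g => Quotient.mk _ g with hf
  have hfiber : ∀ x h : G, f x = f h ↔ h * x⁻¹ ∈ Λ := fun x h => by
    rw [hf, Quotient.eq, QuotientGroup.rightRel_apply]
  refine ⟨blockDiagonal f a, ?_, by simpa using norm_blockDiagonal_le f a, fun g => ?_⟩
  · rw [mem_rightCommutant_iff]
    intro g _ t s
    rw [blockDiagonal_apply, blockDiagonal_apply]
    by_cases h : f t = f s
    · have h' : f (t * g) = f (s * g) := by
        rw [hfiber] at h ⊢
        simpa [mul_assoc] using h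
      rw [restrict_dirac_of_mem (A := {x | f x = f (s * g)}) h',
        restrict_dirac_of_mem (A := {x | f x = f s}) h]
      exact mem_rightCommutant_iff.mp ha g trivial t s
    · have h' : f (t * g) ≠ f (s * g) := by
        rw [hfiber] at h
        refine fun hc => h ?_
        rw [hfiber] at hc
        simpa [mul_assoc] using hc
      rw [restrict_dirac_of_notMem (A := {x | f x = f (s * g)}) h',
        restrict_dirac_of_notMem (A := {x | f x = f s}) h]
      simp
  · rw [groupCoeff, blockDiagonal_apply]
    by_cases h : f 1 = f g
    · have hg : g ∈ (Λ : Set G) := by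
        rw [hfiber] at h
        simpa using h
      rw [restrict_dirac_of_mem (A := {x | f x = f g}) h, Set.indicator_of_mem hg, groupCoeff]
    · have hg : g ∉ (Λ : Set G) := by
        rw [hfiber] at h
        simpa using h
      rw [restrict_dirac_of_notMem (A := {x | f x = f g}) h, Set.indicator_of_notMem hg]
      simp

theorem groupCoeff_leftRegular_mul_mul {a : EllTwoOp G}
    (ha : a ∈ rightCommutant (⊤ : Subgroup G)) (s t g : G) :
    groupCoeff (leftRegular s * a * leftRegular t) g = groupCoeff a (s⁻¹ * g * t⁻¹) := by
  have : groupCoeff (leftRegular s * a * leftRegular t) g =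
      a (leftRegular t (dirac 1)) (s⁻¹ * g) := rfl
  rw [this, leftRegular_dirac, mul_one, apply_dirac_eq ha, groupCoeff]

theorem norm_leftRegular_mul_mul_le (a : EllTwoOp G) (s t : G) :
    ‖leftRegular s * a * leftRegular t‖ ≤ ‖a‖ := by
  refine (norm_mul_le _ _).trans ?_
  have h1 := norm_mul_le (leftRegular s) a
  have h2 := norm_leftRegular_le s
  have h3 := norm_leftRegular_le t
  have h4 : ‖leftRegular s * a‖ ≤ ‖a‖ := h1.trans (by nlinarith [norm_nonneg a])
  nlinarith [norm_nonneg (leftRegular s * a), norm_nonneg a]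

theorem IsMultiplier.translate {C : ℝ} {A : Set G} (h : IsMultiplier C A) (s t : G) :
    IsMultiplier C ({s} * A * {t}) := by
  refine ⟨h.1, fun a ha => ?_⟩
  have hl : ∀ g, leftRegular g ∈ rightCommutant (⊤ : Subgroup G) :=
    fun g => leftRegular_mem_rightCommutant g ⊤
  obtain ⟨b, hb, hbn, hbf⟩ := h.2 (leftRegular s⁻¹ * a * leftRegular t⁻¹)
    (mul_mem (mul_mem (hl _) ha) (hl _))
  refine ⟨leftRegular s * b * leftRegular t, mul_mem (mul_mem (hl _) hb) (hl _), ?_, fun g => ?_⟩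
  · exact (norm_leftRegular_mul_mul_le _ _ _).trans (hbn.trans
      (mul_le_mul_of_nonneg_left (norm_leftRegular_mul_mul_le _ _ _) h.1))
  · rw [groupCoeff_leftRegular_mul_mul hb, hbf]
    have hmem : g ∈ {s} * A * {t} ↔ s⁻¹ * g * t⁻¹ ∈ A := by
      simp [Set.singleton_mul, Set.mul_singleton, mul_assoc]
    by_cases hg : s⁻¹ * g * t⁻¹ ∈ A
    · rw [Set.indicator_of_mem hg, Set.indicator_of_mem (hmem.mpr hg),
        groupCoeff_leftRegular_mul_mul ha]
      congr 1
      group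
    · rw [Set.indicator_of_notMem hg, Set.indicator_of_notMem (fun hc => hg (hmem.mp hc))]

theorem exists_isMultiplier (Λ : Subgroup G) {F K : Set G} (hF : F.Finite) (hK : K.Finite) :
    ∃ C, IsMultiplier C (F * (Λ : Set G) * K) := by
  induction F, hF using Set.Finite.induction_on with
  | empty => exact ⟨0, by simpa using isMultiplier_empty⟩
  | @insert s F _ _ ih =>
    obtain ⟨C, hC⟩ := ih
    have h1 : ∃ C, IsMultiplier C ({s} * (Λ : Set G) * K) := by
      clear hC
      induction K, hK using Set.Finite.induction_on with
      | empty => exact ⟨0, by simpa using isMultiplier_empty⟩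
      | @insert t K _ _ ih' =>
        obtain ⟨C', hC'⟩ := ih'
        rw [Set.insert_eq, Set.mul_union]
        exact ((isMultiplier_subgroup Λ).translate s t).union hC'
    obtain ⟨C', hC'⟩ := h1
    rw [Set.insert_eq, Set.union_mul, Set.union_mul]
    exact hC'.union hC

/-- The finite partial sum `∑_{g ∈ D} τ(a u_g*) u_g` of the Fourier series. -/
def truncate (a : EllTwoOp G) (D : Finset G) : EllTwoOp G :=
  ∑ g ∈ D, groupCoeff a g • leftRegular g

theorem truncate_mem (a : EllTwoOp G) (D : Finset G) :
    truncate a D ∈ rightCommutant (⊤ : Subgroup G) :=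
  sum_mem fun g _ => (rightCommutant (⊤ : Subgroup G)).smul_mem
    (leftRegular_mem_rightCommutant g ⊤) _

theorem norm_truncate_le (a : EllTwoOp G) (D : Finset G) :
    ‖truncate a D‖ ≤ ∑ g ∈ D, ‖groupCoeff a g‖ := by
  refine (norm_sum_le _ _).trans (Finset.sum_le_sum fun g _ => ?_)
  rw [norm_smul]
  exact mul_le_of_le_one_right (norm_nonneg _) (norm_leftRegular_le g)

theorem groupCoeff_truncate (a : EllTwoOp G) (D : Finset G) (g : G) :
    groupCoeff (truncate a D) g = (D : Set G).indicator (groupCoeff a) g := by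
  have h : groupCoeff (truncate a D) g = ∑ h ∈ D, groupCoeff a h * dirac h g := by
    have : truncate a D (dirac 1) = ∑ h ∈ D, groupCoeff a h • dirac h := by
      simp [truncate, sum_apply, leftRegular_dirac]
    rw [groupCoeff, this, lp.coeFn_sum, Finset.sum_apply]
    rfl
  rw [h]
  by_cases hg : g ∈ D
  · rw [Finset.sum_eq_single_of_mem g hg, dirac_apply_self, mul_one,
      Set.indicator_of_mem (Finset.mem_coe.mpr hg)]
    intro b _ hb
    rw [dirac_apply_ne hb.symm, mul_zero]
  · rw [Set.indicator_of_notMem (fun hc => hg (Finset.mem_coe.mp hc))]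
    refine Finset.sum_eq_zero fun b hb => ?_
    have hne : g ≠ b := by
      rintro rfl
      exact hg hb
    rw [dirac_apply_ne hne, mul_zero]

end Fourier

/-! ### Fourier coefficients of products -/

section Products

theorem norm_ofFn_prod_le {G : Type*} {n : ℕ} (c : Fin n → EllTwoOp G) :
    ‖(List.ofFn c).prod‖ ≤ ∏ t, ‖c t‖ := by
  induction n with
  | zero =>
    simp only [List.ofFn_zero, List.prod_nil, Finset.univ_eq_empty, Finset.prod_empty]
    exact ContinuousLinearMap.norm_id_le
  | succ n ih =>
    rw [List.ofFn_succ, List.prod_cons, Fin.prod_univ_succ]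
    refine (norm_mul_le _ _).trans ?_
    gcongr
    exact ih _

variable {G : Type*} [Group G]

theorem ofFn_prod_mem {n : ℕ} {c : Fin n → EllTwoOp G}
    (hc : ∀ t, c t ∈ rightCommutant (⊤ : Subgroup G)) :
    (List.ofFn c).prod ∈ rightCommutant (⊤ : Subgroup G) := by
  refine list_prod_mem fun a ha => ?_
  obtain ⟨t, rfl⟩ := (List.mem_ofFn' c a).mp ha
  exact hc t

/-- The support of a product is contained in the product of the supports. -/
theorem exists_tuple_of_groupCoeff_prod_ne_zero {n : ℕ} {c : Fin n → EllTwoOp G}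
    (hc : ∀ t, c t ∈ rightCommutant (⊤ : Subgroup G)) {s : G}
    (hs : groupCoeff (List.ofFn c).prod s ≠ 0) :
    ∃ h : Fin n → G, (∀ t, groupCoeff (c t) (h t) ≠ 0) ∧ (List.ofFn h).prod = s := by
  induction n generalizing s with
  | zero =>
    refine ⟨fun t => t.elim0, fun t => t.elim0, ?_⟩
    by_contra hne
    refine hs ?_
    simp only [List.ofFn_zero, List.prod_nil] at hne ⊢
    rw [groupCoeff_one, dirac_apply_ne (fun h => hne h.symm)]
  | succ n ih =>
    rw [List.ofFn_succ, List.prod_cons] at hs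
    have hsum := hasSum_groupCoeff_mul (hc 0) (List.ofFn fun i => c i.succ).prod s
    obtain ⟨r, hr⟩ : ∃ r, groupCoeff (List.ofFn fun i => c i.succ).prod r *
        groupCoeff (c 0) (s * r⁻¹) ≠ 0 := by
      by_contra! hcon
      refine hs (hsum.unique ?_)
      simpa only [hcon] using hasSum_zero
    obtain ⟨h, hh, hprod⟩ := ih (fun t => hc t.succ) (left_ne_zero_of_mul hr)
    refine ⟨Fin.cons (s * r⁻¹) h, fun t => ?_, ?_⟩
    · refine Fin.cases ?_ (fun t => ?_) t
      · simpa using right_ne_zero_of_mul hr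
      · simpa using hh t
    · simp [List.ofFn_succ, hprod]

/-- The Fourier coefficient of a product at `s` only depends on the coefficients of the factors
that occur in a factorization of `s`. -/
theorem groupCoeff_prod_congr {n : ℕ} {c c' : Fin n → EllTwoOp G}
    (hc : ∀ t, c t ∈ rightCommutant (⊤ : Subgroup G))
    (hc' : ∀ t, c' t ∈ rightCommutant (⊤ : Subgroup G)) {s : G}
    (h : ∀ h : Fin n → G, (List.ofFn h).prod = s →
      (∀ t, groupCoeff (c t) (h t) ≠ 0 ∨ groupCoeff (c' t) (h t) ≠ 0) →
      ∀ t, groupCoeff (c t) (h t) = groupCoeff (c' t) (h t)) :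
    groupCoeff (List.ofFn c).prod s = groupCoeff (List.ofFn c').prod s := by
  induction n generalizing s with
  | zero => simp
  | succ n ih =>
    rw [List.ofFn_succ, List.prod_cons, List.ofFn_succ, List.prod_cons]
    have h1 := hasSum_groupCoeff_mul (hc 0) (List.ofFn fun i => c i.succ).prod s
    have h2 := hasSum_groupCoeff_mul (hc' 0) (List.ofFn fun i => c' i.succ).prod s
    refine h1.unique ?_
    convert h2 using 2 with r
    by_cases h0 : groupCoeff (c 0) (s * r⁻¹) ≠ 0 ∨ groupCoeff (c' 0) (s * r⁻¹) ≠ 0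
    · have hext : ∀ k : Fin n → G, (List.ofFn k).prod = r →
          (∀ t, groupCoeff (c t.succ) (k t) ≠ 0 ∨ groupCoeff (c' t.succ) (k t) ≠ 0) →
          ∀ t, groupCoeff (c t) (Fin.cons (α := fun _ => G) (s * r⁻¹) k t) =
            groupCoeff (c' t) (Fin.cons (α := fun _ => G) (s * r⁻¹) k t) := by
        intro k hk hk'
        refine h _ (by simp [List.ofFn_succ, hk]) fun t => ?_
        refine Fin.cases ?_ (fun t => ?_) t
        · simpa using h0
        · simpa using hk' t
      have htail : groupCoeff (List.ofFn fun i => c i.succ).prod r =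
          groupCoeff (List.ofFn fun i => c' i.succ).prod r :=
        ih (fun t => hc t.succ) (fun t => hc' t.succ) fun k hk hk' t => by
          simpa using hext k hk hk' t.succ
      rw [htail]
      by_cases hz : groupCoeff (List.ofFn fun i => c' i.succ).prod r = 0
      · rw [hz, zero_mul, zero_mul]
      · obtain ⟨k, hk, hkr⟩ := exists_tuple_of_groupCoeff_prod_ne_zero (fun t => hc' t.succ) hz
        have := hext k hkr (fun t => Or.inr (hk t)) 0
        rw [Fin.cons_zero] at this
        rw [this]
    · push Not at h0
      rw [h0.1, h0.2, mul_zero, mul_zero]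

/-- Contractions `a t` can be replaced one after the other inside a product, with a small error in
the 2-norm: the admissible error `ε t` for the factor `a t` is chosen after bounds `C s`, `s < t`,
on the operator norms of the preceding replacements are known. -/
theorem exists_approx_parameters {n : ℕ} (Good : Fin n → ℝ → ℝ → Prop)
    (hGood : ∀ t, ∀ ε : ℝ, 0 < ε → ∃ C : ℝ, 1 ≤ C ∧ Good t ε C) {δ : ℝ} (hδ : 0 < δ) :
    ∃ ε C : Fin n → ℝ, (∀ t, 0 < ε t) ∧ (∀ t, 1 ≤ C t) ∧ (∀ t, Good t (ε t) (C t)) ∧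
      ∀ a b : Fin n → EllTwoOp G, (∀ t, a t ∈ rightCommutant (⊤ : Subgroup G)) →
        (∀ t, b t ∈ rightCommutant (⊤ : Subgroup G)) → (∀ t, ‖a t‖ ≤ 1) → (∀ t, ‖b t‖ ≤ C t) →
        (∀ t, ‖(a t - b t) (dirac 1)‖ ≤ ε t) →
        ‖((List.ofFn a).prod - (List.ofFn b).prod) (dirac 1)‖ ≤ δ := by
  induction n generalizing δ with
  | zero =>
    refine ⟨fun t => t.elim0, fun t => t.elim0, fun t => t.elim0, fun t => t.elim0,
      fun t => t.elim0, fun a b _ _ _ _ _ => ?_⟩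
    simpa using hδ.le
  | succ n ih =>
    obtain ⟨C₀, hC₀, hG₀⟩ := hGood 0 (δ / 2) (by positivity)
    obtain ⟨ε, C, hε, hC, hG, happ⟩ := ih (fun t => Good t.succ) (fun t => hGood t.succ)
      (δ := δ / (2 * C₀)) (by positivity)
    refine ⟨Fin.cons (δ / 2) ε, Fin.cons C₀ C, ?_, ?_, ?_, fun a b ha hb ha1 hbC hab => ?_⟩
    · exact fun t => Fin.cases (by simpa using hδ) (fun t => by simpa using hε t) t
    · exact fun t => Fin.cases (by simpa using hC₀) (fun t => by simpa using hC t) t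
    · exact fun t => Fin.cases (by simpa using hG₀) (fun t => by simpa using hG t) t
    · have htail := happ (fun t => a t.succ) (fun t => b t.succ) (fun t => ha _) (fun t => hb _)
        (fun t => ha1 _) (fun t => by simpa using hbC t.succ) (fun t => by simpa using hab t.succ)
      have hb0 : ‖b 0‖ ≤ C₀ := by simpa using hbC 0
      have hab0 : ‖(a 0 - b 0) (dirac 1)‖ ≤ δ / 2 := by simpa using hab 0
      set A := (List.ofFn fun t => a t.succ).prod with hA
      set B := (List.ofFn fun t => b t.succ).prod with hB
      have hAmem : A ∈ rightCommutant (⊤ : Subgroup G) := ofFn_prod_mem fun t => ha _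
      have hA1 : ‖A‖ ≤ 1 := (norm_ofFn_prod_le _).trans
        (Finset.prod_le_one (fun t _ => norm_nonneg _) fun t _ => ha1 _)
      have hsplit : ((List.ofFn a).prod - (List.ofFn b).prod) (dirac 1) =
          ((a 0 - b 0) * A) (dirac 1) + b 0 ((A - B) (dirac 1)) := by
        rw [List.ofFn_succ, List.prod_cons, List.ofFn_succ, List.prod_cons, ← hA, ← hB,
          ← mul_apply_eq_comp, ← add_apply]
        congr 1
        noncomm_ring
      rw [hsplit]
      refine (norm_add_le _ _).trans ?_
      have h1 : ‖((a 0 - b 0) * A) (dirac 1)‖ ≤ δ / 2 :=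
        (norm_mul_apply_dirac_one_le (sub_mem (ha 0) (hb 0)) hAmem).trans
          (by nlinarith [norm_nonneg ((a 0 - b 0) (dirac 1)), norm_nonneg A])
      have h2 : ‖b 0 ((A - B) (dirac 1))‖ ≤ δ / 2 := by
        refine ((b 0).le_opNorm _).trans ?_
        calc ‖b 0‖ * ‖(A - B) (dirac 1)‖ ≤ C₀ * (δ / (2 * C₀)) := by gcongr
          _ = δ / 2 := by field_simp
      linarith

end Products

/-! ### Fixability for tuples with trivial entries -/

section Fixable

variable {G : Type*} [Group G]

theorem exists_avoid_pair {X : Type*} {e : Fin 3 → X} (he : Function.Injective e) (x y : X) :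
    ∃ c, e c ≠ x ∧ e c ≠ y := by
  by_contra hcon
  have hcon' : ∀ c, e c = x ∨ e c = y := fun c => by
    by_contra h
    exact hcon ⟨c, fun hx => h (Or.inl hx), fun hy => h (Or.inr hy)⟩
  have h01 : e 0 ≠ e 1 := fun h => absurd (he h) (by decide)
  have h02 : e 0 ≠ e 2 := fun h => absurd (he h) (by decide)
  have h12 : e 1 ≠ e 2 := fun h => absurd (he h) (by decide)
  rcases hcon' 0 with h0 | h0 <;> rcases hcon' 1 with h1 | h1 <;> rcases hcon' 2 with h2 | h2 <;>
    simp_all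

/-- Inserting elements `e (κ 1), …` and their inverses between consecutive entries, with prescribed
outer factors `(e a)⁻¹` and `e b`, a tuple of at least two group elements can be changed into one
without trivial entries. Three values of `e` suffice, as at most two are excluded at each step. -/
theorem exists_shift {e : Fin 3 → G} (he : Function.Injective e) (b : Fin 3) {n : ℕ}
    (h : Fin (n + 2) → G) (a : Fin 3) :
    ∃ κ : Fin (n + 3) → Fin 3, κ 0 = a ∧ κ (Fin.last _) = b ∧
      ∀ i : Fin (n + 2), (e (κ i.castSucc))⁻¹ * h i * e (κ i.succ) ≠ 1 := by
  induction n generalizing a with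
  | zero =>
    obtain ⟨c, hc1, hc2⟩ := exists_avoid_pair he ((h 0)⁻¹ * e a) (h 1 * e b)
    refine ⟨![a, c, b], rfl, rfl, fun i => ?_⟩
    fin_cases i
    · intro hcon
      refine hc1 ?_
      have hcon' : (e a)⁻¹ * h 0 * e c = 1 := hcon
      rw [mul_assoc, inv_mul_eq_one] at hcon'
      rw [hcon']
      group
    · intro hcon
      refine hc2 ?_
      have hcon' : (e c)⁻¹ * h 1 * e b = 1 := hcon
      rw [mul_assoc, inv_mul_eq_one] at hcon'
      exact hcon'
  | succ n ih =>
    obtain ⟨c, hc, -⟩ := exists_avoid_pair he ((h 0)⁻¹ * e a) 1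
    obtain ⟨κ, hκ0, hκl, hκ⟩ := ih (fun i => h i.succ) c
    refine ⟨Fin.cons a κ, rfl, ?_, fun i => ?_⟩
    · rw [← Fin.succ_last, Fin.cons_succ, hκl]
    · refine Fin.cases ?_ (fun i => ?_) i
      · intro hcon
        refine hc ?_
        have hcon' : (e a)⁻¹ * h 0 * e (κ 0) = 1 := hcon
        rw [hκ0, mul_assoc, inv_mul_eq_one] at hcon'
        rw [hcon']
        group
      · simpa using hκ i

theorem ofFn_shift_prod {n : ℕ} (s : Fin (n + 1) → G) (h : Fin n → G) :
    (List.ofFn fun i => (s i.castSucc)⁻¹ * h i * s i.succ).prod =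
      (s 0)⁻¹ * (List.ofFn h).prod * s (Fin.last n) := by
  induction n with
  | zero => simp
  | succ n ih =>
    rw [List.ofFn_succ, List.prod_cons, List.ofFn_succ, List.prod_cons]
    have := ih (fun i => s i.succ) (fun i => h i.succ)
    simp only [Fin.succ_castSucc, Fin.succ_last] at this
    rw [this, Fin.castSucc_zero]
    simp only [Nat.succ_eq_add_one]
    group

/-- In an infinite group, the conclusion of fixability also holds for tuples some of whose entries
are trivial. -/
theorem IsFixable.exists_maps [Infinite G] {n : ℕ} (hn : 2 ≤ n) {I J : Finset (Fin n)}
    {S : Subgroup G} {Γ : Fin n → Subgroup G} (hfix : IsFixable I J S Γ) (F K : Fin n → Set G)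
    (hF : ∀ i, (F i).Finite) (hK : ∀ i, (K i).Finite) :
    ∃ (E : Fin n → Set G) (l : Fin n → ℕ)
      (σ : (i : Fin n) → Fin (l i) × Fin 3 × Fin 3 → {g : S // g ≠ 1} → G),
      (∀ j ∈ J, (E j).Finite) ∧ (∀ i ∈ I, ∀ k, Function.Injective (σ i k)) ∧
      ∀ (g : {g : S // g ≠ 1}) (h : Fin n → G), (∀ i, h i ∈ F i * (Γ i : Set G) * K i) →
        (∀ j ∈ J, h j ∉ E j) → ((g : S) : G) * (List.ofFn h).prod = 1 →
        ∀ i ∈ I, ∃ k, h i = σ i k g := by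
  obtain ⟨m, rfl⟩ : ∃ m, n = m + 2 := ⟨n - 2, by omega⟩
  set f : ℕ ↪ G := Infinite.natEmbedding G
  set e : Fin 3 → G := fun k => (f 0)⁻¹ * f k with he_def
  have he : Function.Injective e := fun a b hab => by
    have := f.injective (mul_left_cancel hab)
    exact Fin.ext this
  have he0 : e 0 = 1 := by simp [he_def]
  have hfin : (Set.range e).Finite := Set.finite_range e
  -- The shifted tuple `e(κ i)⁻¹ h i e(κ (i + 1))` has the same product as `h`, because `e 0 = 1`.
  obtain ⟨E, l, σ, hE, hσ, hmain⟩ := hfix.2 (fun i => (Set.range e)⁻¹ * F i)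
    (fun i => K i * Set.range e) (fun i => hfin.inv.mul (hF i)) (fun i => (hK i).mul hfin)
  refine ⟨fun j => Set.range e * E j * (Set.range e)⁻¹, l,
    fun i k g => e k.2.1 * σ i k.1 g * (e k.2.2)⁻¹, fun j hj => ?_, fun i hi k a b hab => ?_,
    fun g h hh hhE hprod i hi => ?_⟩
  · exact (hfin.mul (hE j hj).1).mul hfin.inv
  · exact hσ i hi k.1 (mul_left_cancel (mul_right_cancel hab))
  · obtain ⟨κ, hκ0, hκl, hκ⟩ := exists_shift he 0 h 0
    have hprod' : ((g : S) : G) *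
        (List.ofFn fun i => (e (κ i.castSucc))⁻¹ * h i * e (κ i.succ)).prod = 1 := by
      rw [ofFn_shift_prod (fun i => e (κ i)) h, hκ0, hκl, he0]
      simpa using hprod
    have hmem : ∀ i, (e (κ i.castSucc))⁻¹ * h i * e (κ i.succ) ∈
        (Set.range e)⁻¹ * F i * (Γ i : Set G) * (K i * Set.range e) := by
      intro i
      obtain ⟨_, ⟨x, hx, y, hy, rfl⟩, z, hz, hxyz⟩ := hh i
      refine ⟨(e (κ i.castSucc))⁻¹ * x * y, ⟨(e (κ i.castSucc))⁻¹ * x,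
        ⟨_, Set.inv_mem_inv.mpr ⟨_, rfl⟩, x, hx, rfl⟩, y, hy, rfl⟩, z * e (κ i.succ),
        ⟨z, hz, _, ⟨_, rfl⟩, rfl⟩, ?_⟩
      simp only at hxyz ⊢
      rw [← hxyz]
      simp only [mul_assoc]
    have hnotMem : ∀ j ∈ J, (e (κ j.castSucc))⁻¹ * h j * e (κ j.succ) ∉ E j := by
      intro j hj hcon
      refine hhE j hj ⟨e (κ j.castSucc) * ((e (κ j.castSucc))⁻¹ * h j * e (κ j.succ)),
        ⟨_, ⟨_, rfl⟩, _, hcon, rfl⟩, (e (κ j.succ))⁻¹, Set.inv_mem_inv.mpr ⟨_, rfl⟩, ?_⟩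
      simp only
      group
    obtain ⟨k, hk⟩ := hmain g (fun i => (e (κ i.castSucc))⁻¹ * h i * e (κ i.succ))
      (fun i => ⟨hmem i, hκ i⟩) hnotMem hprod' i hi
    exact ⟨(k, κ i.castSucc, κ i.succ), by
      change h i = e (κ i.castSucc) * σ i k g * (e (κ i.succ))⁻¹
      rw [← hk]
      group⟩

end Fixable

/-! ### The height estimate -/

section Height

theorem norm_unitary_apply {G : Type*} {v : EllTwoOp G} (hv : v ∈ unitary (EllTwoOp G))
    (ξ : EllTwo G) :
    ‖v ξ‖ = ‖ξ‖ := by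
  refine le_antisymm ?_ ?_
  · exact (v.le_opNorm ξ).trans (by
      nlinarith [norm_le_one_of_mem_unitary hv, norm_nonneg ξ])
  · have h1 : ξ = star v (v ξ) := by
      rw [← mul_apply_eq_comp, (Unitary.mem_iff.mp hv).1]
      rfl
    have h2 : ‖star v‖ ≤ 1 := norm_le_one_of_mem_unitary (Unitary.star_mem hv)
    calc ‖ξ‖ = ‖star v (v ξ)‖ := by rw [← h1]
      _ ≤ ‖star v‖ * ‖v ξ‖ := (star v).le_opNorm _
      _ ≤ ‖v ξ‖ := by nlinarith [norm_nonneg (v ξ)]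

variable {G : Type*} [Group G]

theorem groupTrace_mul_star_leftRegular {v : EllTwoOp G}
    (hv : v ∈ rightCommutant (⊤ : Subgroup G)) (g : G) :
    groupTrace (v * star (leftRegular g)) = groupCoeff v g := by
  rw [groupTrace, inner_dirac, star_leftRegular, mul_apply_eq_comp, leftRegular_dirac, mul_one,
    apply_dirac_eq hv, one_mul, inv_inv, groupCoeff]

theorem groupCoeff_eq_zero_of_notMem {S : Subgroup G} {v : EllTwoOp G} (hv : v ∈ groupVN S) {g : G}
    (hg : g ∉ S) : groupCoeff v g = 0 := by
  rw [groupCoeff, ← restrict_apply_dirac_one_of_mem_groupVN hv]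
  exact restrict_apply_of_notMem hg _

theorem enorm_groupCoeff_le_elementHeight {S : Subgroup G} {v : EllTwoOp G} (hv : v ∈ groupVN S)
    (g : G) : ‖groupCoeff v g‖ₑ ≤ elementHeight S v := by
  by_cases hg : g ∈ S
  · rw [← groupTrace_mul_star_leftRegular (groupVN_le_rightCommutant hv)]
    exact le_iSup (fun γ : S => ‖groupTrace (v * star (leftRegular (γ : G)))‖ₑ) ⟨g, hg⟩
  · rw [groupCoeff_eq_zero_of_notMem hv hg]
    simp

/-- In a finite group the height of a unitary is bounded below by Parseval's identity. -/
theorem inv_card_le_elementHeight [Finite G] {S : Subgroup G} {v : EllTwoOp G}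
    (hv : v ∈ groupVN S) (hvu : v ∈ unitary (EllTwoOp G)) :
    (Nat.card G : ℝ≥0∞)⁻¹ ≤ elementHeight S v := by
  have := Fintype.ofFinite G
  have h1 : (1 : ℝ≥0∞) = ∑' g, ‖groupCoeff v g‖ₑ ^ 2 := by
    have h := enorm_sq_eq_tsum (v (dirac 1))
    rw [← ofReal_norm, norm_unitary_apply hvu, norm_dirac, ENNReal.ofReal_one, one_pow] at h
    exact h
  have h2 : (1 : ℝ≥0∞) ≤ Nat.card G * elementHeight S v := by
    rw [h1]
    calc ∑' g, ‖groupCoeff v g‖ₑ ^ 2 ≤ ∑' _ : G, elementHeight S v := by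
          refine ENNReal.tsum_le_tsum fun g => ?_
          refine le_trans ?_ (enorm_groupCoeff_le_elementHeight hv g)
          refine pow_le_of_le_one zero_le ?_ two_ne_zero
          rw [← ofReal_norm]
          exact ENNReal.ofReal_le_one.mpr
            ((norm_groupCoeff_le v g).trans (norm_le_one_of_mem_unitary hvu))
      _ = Nat.card G * elementHeight S v := by
          rw [tsum_fintype, Finset.sum_const, nsmul_eq_mul, Nat.card_eq_fintype_card]
          rfl
  rw [ENNReal.inv_le_iff_le_mul (by simp) (by simp)]
  exact h2

theorem norm_truncate_image_le [DecidableEq G] {κ : Type*} [Fintype κ] (d : κ → G)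
    (a : EllTwoOp G) :
    ‖truncate a (Finset.univ.image d)‖ ≤ ∑ k, ‖groupCoeff a (d k)‖ :=
  (norm_truncate_le _ _).trans (Finset.sum_image_le_of_nonneg fun _ _ => norm_nonneg _)

/-- If a factorization of `g⁻¹` along the supports of `c` determines two of its entries up to
finitely many choices, then the coefficient of the product at `g⁻¹` is controlled by the
coefficients of the two corresponding factors at these choices. -/
theorem enorm_groupCoeff_prod_le {n : ℕ} {c : Fin n → EllTwoOp G} {C : Fin n → ℝ}
    (hc : ∀ t, c t ∈ rightCommutant (⊤ : Subgroup G)) (hC : ∀ t, 1 ≤ C t)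
    (hcC : ∀ t, ‖c t‖ ≤ C t) {i₁ i₂ : Fin n} (hne : i₁ ≠ i₂) {κ₁ κ₂ : Type*} [Fintype κ₁]
    [Fintype κ₂] (d₁ : κ₁ → G) (d₂ : κ₂ → G) {s : G}
    (h : ∀ h : Fin n → G, (List.ofFn h).prod = s → (∀ t, groupCoeff (c t) (h t) ≠ 0) →
      (∃ k, h i₁ = d₁ k) ∧ ∃ k, h i₂ = d₂ k) :
    ‖groupCoeff (List.ofFn c).prod s‖ₑ ≤ ENNReal.ofReal (∏ t, C t) *
      ((∑ k, ‖groupCoeff (c i₁) (d₁ k)‖ₑ) * ∑ k, ‖groupCoeff (c i₂) (d₂ k)‖ₑ) := by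
  classical
  set D₁ := Finset.univ.image d₁
  set D₂ := Finset.univ.image d₂
  -- Truncating these two factors makes their norms small and keeps the coefficient at `s`.
  set c' : Fin n → EllTwoOp G := fun t =>
    if t = i₁ then truncate (c t) D₁ else if t = i₂ then truncate (c t) D₂ else c t with hc'
  have hc'mem : ∀ t, c' t ∈ rightCommutant (⊤ : Subgroup G) := by
    intro t
    simp only [hc']
    split_ifs
    · exact truncate_mem _ _
    · exact truncate_mem _ _
    · exact hc t
  have hcoeff : ∀ t g, groupCoeff (c' t) g = groupCoeff (c t) g ∨ groupCoeff (c' t) g = 0 := by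
    intro t g
    simp only [hc']
    split_ifs
    · rw [groupCoeff_truncate]
      by_cases hg : g ∈ (D₁ : Set G)
      · exact Or.inl (Set.indicator_of_mem hg _)
      · exact Or.inr (Set.indicator_of_notMem hg _)
    · rw [groupCoeff_truncate]
      by_cases hg : g ∈ (D₂ : Set G)
      · exact Or.inl (Set.indicator_of_mem hg _)
      · exact Or.inr (Set.indicator_of_notMem hg _)
    · exact Or.inl rfl
  have heq : groupCoeff (List.ofFn c).prod s = groupCoeff (List.ofFn c').prod s := by
    refine groupCoeff_prod_congr hc hc'mem fun k hk hsupp t => ?_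
    have hsupp' : ∀ t, groupCoeff (c t) (k t) ≠ 0 := by
      intro t
      rcases hsupp t with h1 | h1
      · exact h1
      · rcases hcoeff t (k t) with h2 | h2
        · rwa [h2] at h1
        · exact absurd h2 h1
    obtain ⟨⟨k₁, hk₁⟩, k₂, hk₂⟩ := h k hk hsupp'
    simp only [hc']
    split_ifs with ht1 ht2
    · subst ht1
      rw [groupCoeff_truncate, Set.indicator_of_mem]
      rw [hk₁]
      exact Finset.mem_coe.mpr (Finset.mem_image_of_mem _ (Finset.mem_univ _))
    · subst ht2
      rw [groupCoeff_truncate, Set.indicator_of_mem]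
      rw [hk₂]
      exact Finset.mem_coe.mpr (Finset.mem_image_of_mem _ (Finset.mem_univ _))
    · rfl
  set α := ∑ k, ‖groupCoeff (c i₁) (d₁ k)‖ with hα
  set β := ∑ k, ‖groupCoeff (c i₂) (d₂ k)‖ with hβ
  have hα0 : 0 ≤ α := Finset.sum_nonneg fun _ _ => norm_nonneg _
  have hβ0 : 0 ≤ β := Finset.sum_nonneg fun _ _ => norm_nonneg _
  have hnorm : ‖groupCoeff (List.ofFn c).prod s‖ ≤ (∏ t, C t) * (α * β) := by
    rw [heq]
    refine (norm_groupCoeff_le _ _).trans ((norm_ofFn_prod_le c').trans ?_)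
    calc ∏ t, ‖c' t‖ ≤ ∏ t, (C t * ((if t = i₁ then α else 1) * (if t = i₂ then β else 1))) := by
          refine Finset.prod_le_prod (fun t _ => norm_nonneg _) fun t _ => ?_
          simp only [hc']
          split_ifs with h1 h2 h2
          · exact absurd (h1.symm.trans h2) hne
          · subst h1
            have := norm_truncate_image_le d₁ (c t)
            nlinarith [hC t]
          · subst h2
            have := norm_truncate_image_le d₂ (c t)
            nlinarith [hC t]
          · simpa using hcC t
      _ = (∏ t, C t) * (α * β) := by
          rw [Finset.prod_mul_distrib, Finset.prod_mul_distrib, Finset.prod_ite_eq',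
            Finset.prod_ite_eq']
          simp
  have hprod0 : 0 ≤ ∏ t, C t := Finset.prod_nonneg fun t _ => zero_le_one.trans (hC t)
  rw [← ofReal_norm]
  refine (ENNReal.ofReal_le_ofReal hnorm).trans_eq ?_
  rw [ENNReal.ofReal_mul hprod0, ENNReal.ofReal_mul hα0, hα, hβ,
    ENNReal.ofReal_sum_of_nonneg (fun _ _ => norm_nonneg _),
    ENNReal.ofReal_sum_of_nonneg (fun _ _ => norm_nonneg _)]
  simp only [ofReal_norm]

/-- Sums of products of square summable coefficients along injective maps are bounded. -/
theorem tsum_sum_mul_sum_le {X κ₁ κ₂ : Type*} [Fintype κ₁] [Fintype κ₂] {a b : EllTwoOp G}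
    {σ₁ : κ₁ → X → G} {σ₂ : κ₂ → X → G} (h₁ : ∀ k, Function.Injective (σ₁ k))
    (h₂ : ∀ k, Function.Injective (σ₂ k)) :
    ∑' g, ((∑ k, ‖groupCoeff a (σ₁ k g)‖ₑ) * ∑ k, ‖groupCoeff b (σ₂ k g)‖ₑ) ≤
      ∑ _k₁ : κ₁, ∑ _k₂ : κ₂, (‖a‖ₑ ^ 2 + ‖b‖ₑ ^ 2) := by
  have hxy : ∀ x y : ℝ≥0∞, x * y ≤ x ^ 2 + y ^ 2 := by
    intro x y
    rcases le_total x y with h | h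
    · calc x * y ≤ y * y := by gcongr
        _ = y ^ 2 := (sq y).symm
        _ ≤ x ^ 2 + y ^ 2 := le_add_self
    · calc x * y ≤ x * x := by gcongr
        _ = x ^ 2 := (sq x).symm
        _ ≤ x ^ 2 + y ^ 2 := le_self_add
  have hinj : ∀ (a : EllTwoOp G) (σ : X → G), Function.Injective σ →
      ∑' g, ‖groupCoeff a (σ g)‖ₑ ^ 2 ≤ ‖a‖ₑ ^ 2 := fun a σ hσ =>
    (ENNReal.tsum_comp_le_tsum_of_injective hσ (fun g => ‖groupCoeff a g‖ₑ ^ 2)).trans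
      (tsum_enorm_groupCoeff_sq_le a)
  simp only [Finset.sum_mul_sum]
  rw [Summable.tsum_finsetSum (fun _ _ => ENNReal.summable)]
  refine Finset.sum_le_sum fun k₁ _ => ?_
  rw [Summable.tsum_finsetSum (fun _ _ => ENNReal.summable)]
  refine Finset.sum_le_sum fun k₂ _ => ?_
  refine (ENNReal.tsum_le_tsum fun g => hxy _ _).trans ?_
  rw [ENNReal.tsum_add]
  exact add_le_add (hinj a _ (h₁ k₁)) (hinj b _ (h₂ k₂))

theorem enorm_groupCoeff_mul_one_le {S : Subgroup G} {v B : EllTwoOp G} (hv : v ∈ groupVN S) :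
    ‖groupCoeff (v * B) 1‖ₑ ≤ elementHeight S v *
      (‖groupCoeff B 1‖ₑ + ∑' g : {g : S // g ≠ 1}, ‖groupCoeff B ((g : S) : G)⁻¹‖ₑ) := by
  have hsum := hasSum_groupCoeff_mul (groupVN_le_rightCommutant hv) B 1
  rw [← hsum.tsum_eq]
  refine enorm_tsum_le_tsum_enorm.trans ?_
  set f : G → ℝ≥0∞ := fun g => ‖groupCoeff B g⁻¹ * groupCoeff v g‖ₑ with hf
  have h1 : ∑' r, ‖groupCoeff B r * groupCoeff v (1 * r⁻¹)‖ₑ = ∑' g, f g := by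
    rw [← (Equiv.inv G).tsum_eq f]
    refine tsum_congr fun r => ?_
    simp [hf]
  have h2 : ∑' g, f g = ∑' g : S, f g := by
    refine (tsum_subtype_eq_of_support_subset (s := (S : Set G)) fun g hg => ?_).symm
    by_contra hgS
    refine hg ?_
    simp [hf, groupCoeff_eq_zero_of_notMem hv hgS]
  have h3 : ∑' g : S, f g ≤ ∑' g : S, elementHeight S v * ‖groupCoeff B ((g : S) : G)⁻¹‖ₑ := by
    refine ENNReal.tsum_le_tsum fun g => ?_
    change ‖groupCoeff B (g : G)⁻¹ * groupCoeff v g‖ₑ ≤ _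
    rw [enorm_mul, mul_comm]
    gcongr
    exact enorm_groupCoeff_le_elementHeight hv _
  rw [h1, h2]
  refine h3.trans ?_
  rw [ENNReal.tsum_mul_left]
  gcongr
  rw [ENNReal.tsum_eq_add_tsum_ite (1 : S)]
  refine add_le_add (by simp) ?_
  rw [← tsum_subtype_eq_of_support_subset (s := {g : S | g ≠ 1})]
  · refine ENNReal.tsum_le_tsum fun g => ?_
    split_ifs
    · exact zero_le
    · exact le_rfl
  · intro g hg h1
    exact hg (if_pos h1)

end Height

section Assembly

variable {G : Type*} [Group G]

/-- Uniform approximation of the unit ball of `P` by elements of controlled operator norm supported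
on a single set `F Λ K`. -/
theorem StronglyIntertwines.exists_multiplier_approx {P : VonNeumannAlgebra (EllTwo G)}
    (hP : P ≤ groupVN (⊤ : Subgroup G)) {Λ : Subgroup G}
    (h : StronglyIntertwines P (groupVN Λ)) {ε : ℝ} (hε : 0 < ε) :
    ∃ C : ℝ, 0 ≤ C ∧ ∃ F K : Set G, F.Finite ∧ K.Finite ∧ ∀ a ∈ P, ‖a‖ ≤ 1 →
      ∃ b ∈ rightCommutant (⊤ : Subgroup G), ‖b‖ ≤ C ∧
        (∀ g, groupCoeff b g = (F * (Λ : Set G) * K).indicator (groupCoeff a) g) ∧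
        ‖(a - b) (dirac 1)‖ ≤ ε := by
  obtain ⟨F, K, hF, hK, happ⟩ := h.exists_finite_approx hP hε
  obtain ⟨C, hC0, hC⟩ := exists_isMultiplier Λ hF hK
  refine ⟨C, hC0, F, K, hF, hK, fun a ha ha1 => ?_⟩
  obtain ⟨b, hb, hbn, hbf⟩ := hC a (mem_groupVN_top_iff.mp (hP ha))
  refine ⟨b, hb, hbn.trans (mul_le_of_le_one_right hC0 ha1), hbf, ?_⟩
  have hext : (a - b) (dirac 1) = restrict (F * (Λ : Set G) * K)ᶜ (a (dirac 1)) := by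
    ext g
    change groupCoeff (a - b) g = (F * (Λ : Set G) * K)ᶜ.indicator (groupCoeff a) g
    rw [groupCoeff_sub, hbf]
    by_cases hg : g ∈ F * (Λ : Set G) * K
    · rw [Set.indicator_of_mem hg, Set.indicator_of_notMem (Set.notMem_compl_iff.mpr hg), sub_self]
    · rw [Set.indicator_of_notMem hg, Set.indicator_of_mem (s := (F * (Λ : Set G) * K)ᶜ) hg,
        sub_zero]
  rw [hext]
  exact happ a ha ha1

theorem tendsto_sum_norm_groupCoeff {x : ℕ → EllTwoOp G}
    (hx : Tendsto (fun k => (ContinuousLinearMapWOT.ofCLM (x k) : EllTwo G →WOT[ℂ] EllTwo G))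
      atTop (𝓝 0)) (E : Finset G) :
    Tendsto (fun k => ∑ g ∈ E, ‖groupCoeff (x k) g‖) atTop (𝓝 0) := by
  rw [← Finset.sum_const_zero (ι := G) (s := E)]
  refine tendsto_finsetSum _ fun g _ => ?_
  have h := ContinuousLinearMapWOT.tendsto_iff_forall_inner_apply_tendsto.mp hx (dirac 1) (dirac g)
  simp only [ContinuousLinearMapWOT.ofCLM_apply, ContinuousLinearMapWOT.zero_apply,
    inner_dirac] at h
  simpa [groupCoeff] using h.norm

end Assembly

end

theorem mainTheorem9 {G : Type*} [Group G] [Countable G] {n : ℕ} (hn : 2 ≤ n)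
    (I J : Finset (Fin n)) (hIJ : IsCompl I J)
    (S : Subgroup G) (Γ : Fin n → Subgroup G) (hfix : IsFixable I J S Γ)
    (M : Fin n → VonNeumannAlgebra (EllTwo G))
    (hM : ∀ i, M i ≤ groupVN (⊤ : Subgroup G))
    (hMΓ : ∀ i, StronglyIntertwines (M i) (groupVN (Γ i)))
    (x : Fin n → ℕ → EllTwoOp G)
    (hxM : ∀ j ∈ J, ∀ k, x j k ∈ M j ∧ ‖x j k‖ ≤ 1)
    (hx0 : ∀ j ∈ J, Tendsto
      (fun k => (ContinuousLinearMapWOT.ofCLM (x j k) : EllTwo G →WOT[ℂ] EllTwo G))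
      atTop (𝓝 0))
    (𝒢 : Set (EllTwoOp G))
    (h𝒢 : ∀ v ∈ 𝒢, v ∈ groupVN S ∧ v ∈ unitary (EllTwoOp G))
    (hrel : ∀ v ∈ 𝒢, ∃ w : Fin n → EllTwoOp G,
      (∀ i ∈ I, w i ∈ M i ∧ w i ∈ unitary (EllTwoOp G)) ∧
      ∀ k : ℕ, v * (List.ofFn fun t => if t ∈ I then w t else x t k).prod = 1) :
    0 < height S 𝒢 := by
  rcases finite_or_infinite G with hG | hG
  · refine lt_of_lt_of_le ?_
      (le_iInf₂ fun v hv => inv_card_le_elementHeight (h𝒢 v hv).1 (h𝒢 v hv).2)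
    simp
  have hJ : ∀ t, t ∉ I → t ∈ J := by
    intro t ht
    have : t ∈ I ⊔ J := by rw [hIJ.sup_eq_top]; exact Finset.mem_univ t
    exact (Finset.mem_union.mp this).resolve_left ht
  have hJI : ∀ t ∈ J, t ∉ I := fun t htJ htI => Finset.disjoint_left.mp hIJ.disjoint htI htJ
  -- Half of the error `ε` and one unit of the bound `C` are reserved for the removal of the
  -- exceptional finite sets below.
  obtain ⟨ε, C, hε, hC, hgood, happ⟩ := exists_approx_parameters
    (fun t ε C => ∃ F K : Set G, F.Finite ∧ K.Finite ∧ ∀ a ∈ M t, ‖a‖ ≤ 1 →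
      ∃ b ∈ rightCommutant (⊤ : Subgroup G), ‖b‖ ≤ C - 1 ∧
        (∀ g, groupCoeff b g = (F * (Γ t : Set G) * K).indicator (groupCoeff a) g) ∧
        ‖(a - b) (dirac 1)‖ ≤ ε / 2)
    (fun t ε hε => by
      obtain ⟨C, hC, h⟩ := (hMΓ t).exists_multiplier_approx (hM t) (half_pos hε)
      exact ⟨C + 1, by linarith, by simpa using h⟩)
    (δ := 1 / 2) (by norm_num) (G := G)
  choose F K hF hK hb using hgood
  obtain ⟨E, l, σ, hE, hσ, hmaps⟩ := hfix.exists_maps hn F K hF hK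
  obtain ⟨i₁, hi₁, i₂, hi₂, hne⟩ := Finset.one_lt_card.mp hfix.1
  set R : ℝ≥0∞ := ENNReal.ofReal (∏ t, C t) * (1 + ∑ _k₁ : Fin (l i₁) × Fin 3 × Fin 3,
    ∑ _k₂ : Fin (l i₂) × Fin 3 × Fin 3, (ENNReal.ofReal (C i₁) ^ 2 + ENNReal.ofReal (C i₂) ^ 2))
    with hR
  have hRtop : R ≠ ∞ := by
    rw [hR]
    refine ENNReal.mul_ne_top ENNReal.ofReal_ne_top
      (ENNReal.add_ne_top.mpr ⟨ENNReal.one_ne_top, ?_⟩)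
    refine ENNReal.sum_ne_top.mpr fun _ _ => ENNReal.sum_ne_top.mpr fun _ _ => ?_
    finiteness
  suffices hmain : ∀ v ∈ 𝒢, (2⁻¹ : ℝ≥0∞) ≤ elementHeight S v * R by
    refine lt_of_lt_of_le (ENNReal.div_pos (by simp) hRtop : 0 < 2⁻¹ / R) (le_iInf₂ fun v hv => ?_)
    exact ENNReal.div_le_of_le_mul (hmain v hv)
  intro v hv
  obtain ⟨hvS, hvu⟩ := h𝒢 v hv
  obtain ⟨w, hw, hone⟩ := hrel v hv
  -- Choose `k` so that the coefficients of `x j k` on the exceptional sets are negligible.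
  obtain ⟨k, hk⟩ : ∃ k, ∀ j, ∀ hj : j ∈ J,
      ∑ g ∈ (hE j hj).toFinset, ‖groupCoeff (x j k) g‖ ≤ min 1 (ε j / 2) := by
    refine Eventually.exists (f := atTop) (eventually_all.mpr fun j => ?_)
    by_cases hj : j ∈ J
    · have hpos : (0 : ℝ) < min 1 (ε j / 2) := lt_min one_pos (half_pos (hε j))
      filter_upwards [(tendsto_sum_norm_groupCoeff (hx0 j hj)
        (hE j hj).toFinset).eventually_le_const hpos] with k hk _
      exact hk
    · exact Eventually.of_forall fun k hj' => absurd hj' hj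
  set a : Fin n → EllTwoOp G := fun t => if t ∈ I then w t else x t k with ha
  have haM : ∀ t, a t ∈ M t ∧ ‖a t‖ ≤ 1 := by
    intro t
    by_cases ht : t ∈ I
    · simp only [ha, if_pos ht]
      exact ⟨(hw t ht).1, norm_le_one_of_mem_unitary (hw t ht).2⟩
    · simp only [ha, if_neg ht]
      exact hxM t (hJ t ht) k
  have hamem : ∀ t, a t ∈ rightCommutant (⊤ : Subgroup G) :=
    fun t => mem_groupVN_top_iff.mp (hM t (haM t).1)
  have hbex := fun t => hb t (a t) (haM t).1 (haM t).2
  -- The replacement of `a t` is supported on `F Γ K`, and avoids the exceptional set if `t ∈ J`.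
  have hcex : ∀ t, ∃ c ∈ rightCommutant (⊤ : Subgroup G), ‖c‖ ≤ C t ∧
      ‖(a t - c) (dirac 1)‖ ≤ ε t ∧ ∀ g, groupCoeff c g ≠ 0 →
        g ∈ F t * (Γ t : Set G) * K t ∧ (t ∈ J → g ∉ E t) := by
    intro t
    obtain ⟨b, hbmem, hbn, hbf, hbapp⟩ := hbex t
    have hbsupp : ∀ g, groupCoeff b g ≠ 0 → g ∈ F t * (Γ t : Set G) * K t := by
      intro g hg
      by_contra hc
      exact hg (by rw [hbf, Set.indicator_of_notMem hc])
    by_cases ht : t ∈ J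
    · set D := (hE t ht).toFinset with hD
      have hDsum : ∑ g ∈ D, ‖groupCoeff b g‖ ≤ min 1 (ε t / 2) := by
        refine le_trans (Finset.sum_le_sum fun g _ => ?_) (hk t ht)
        have hat : a t = x t k := if_neg (hJI t ht)
        rw [hbf, hat]
        exact norm_indicator_le_norm_self _ _
      have htr := (norm_truncate_le b D).trans hDsum
      refine ⟨b - truncate b D, sub_mem hbmem (truncate_mem _ _), ?_, ?_, fun g hg => ?_⟩
      · have := norm_sub_le b (truncate b D)
        linarith [htr.trans (min_le_left _ _)]
      · have hsplit : (a t - (b - truncate b D)) (dirac 1) =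
            (a t - b) (dirac 1) + truncate b D (dirac 1) := by
          rw [← add_apply]
          congr 1
          abel
        have h1 : ‖truncate b D (dirac 1)‖ ≤ ε t / 2 := by
          refine ((truncate b D).le_opNorm _).trans ?_
          rw [norm_dirac, mul_one]
          exact htr.trans (min_le_right _ _)
        rw [hsplit]
        exact (norm_add_le _ _).trans (by linarith)
      · rw [groupCoeff_sub, groupCoeff_truncate] at hg
        by_cases hgD : g ∈ (D : Set G)
        · rw [Set.indicator_of_mem hgD, sub_self] at hg
          exact absurd rfl hg
        · rw [Set.indicator_of_notMem hgD, sub_zero] at hg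
          exact ⟨hbsupp g hg, fun _ hgE => hgD (by simpa [hD] using hgE)⟩
    · exact ⟨b, hbmem, by linarith, by linarith [hε t], fun g hg =>
        ⟨hbsupp g hg, fun h => absurd h ht⟩⟩
  choose c hcmem hcn hcapp hcsupp using hcex
  have herr := happ a c hamem hcmem (fun t => (haM t).2) hcn hcapp
  set B := (List.ofFn c).prod with hB
  have hprodC : ‖B‖ ≤ ∏ t, C t := (norm_ofFn_prod_le c).trans
    (Finset.prod_le_prod (fun t _ => norm_nonneg _) fun t _ => hcn t)
  have hlow : (2⁻¹ : ℝ≥0∞) ≤ ‖groupCoeff (v * B) 1‖ₑ := by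
    have h1 : groupCoeff (v * (List.ofFn a).prod) 1 = 1 := by
      rw [hone k, groupCoeff_one, dirac_apply_self]
    have h2 : groupCoeff (v * B) 1 = 1 - groupCoeff (v * ((List.ofFn a).prod - B)) 1 := by
      rw [mul_sub, groupCoeff_sub, h1]
      ring
    have h3 : ‖groupCoeff (v * ((List.ofFn a).prod - B)) 1‖ ≤ 1 / 2 := by
      refine (norm_apply_le _ _).trans ?_
      rw [mul_apply_eq_comp, norm_unitary_apply hvu]
      exact herr
    have h4 : (1 / 2 : ℝ) ≤ ‖groupCoeff (v * B) 1‖ := by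
      rw [h2]
      have := norm_sub_norm_le (1 : ℂ) (groupCoeff (v * ((List.ofFn a).prod - B)) 1)
      rw [norm_one] at this
      linarith
    rw [← ofReal_norm]
    refine le_trans (le_of_eq ?_) (ENNReal.ofReal_le_ofReal h4)
    rw [one_div, ENNReal.ofReal_inv_of_pos two_pos, ENNReal.ofReal_ofNat]
  refine hlow.trans ((enorm_groupCoeff_mul_one_le hvS).trans ?_)
  gcongr
  rw [hR, mul_add, mul_one]
  have hcn' : ∀ t, ‖c t‖ₑ ≤ ENNReal.ofReal (C t) := by
    intro t
    rw [← ofReal_norm]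
    exact ENNReal.ofReal_le_ofReal (hcn t)
  refine add_le_add ?_ ?_
  · rw [← ofReal_norm]
    exact ENNReal.ofReal_le_ofReal ((norm_groupCoeff_le _ _).trans hprodC)
  · calc ∑' g : {g : S // g ≠ 1}, ‖groupCoeff B ((g : S) : G)⁻¹‖ₑ
        ≤ ∑' g : {g : S // g ≠ 1}, ENNReal.ofReal (∏ t, C t) *
            ((∑ k, ‖groupCoeff (c i₁) (σ i₁ k g)‖ₑ) * ∑ k, ‖groupCoeff (c i₂) (σ i₂ k g)‖ₑ) := by
          refine ENNReal.tsum_le_tsum fun g => ?_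
          refine enorm_groupCoeff_prod_le hcmem hC hcn hne _ _ fun h hh hsupp => ?_
          have hfixed := hmaps g h (fun t => (hcsupp t _ (hsupp t)).1)
            (fun t ht => (hcsupp t _ (hsupp t)).2 ht) (by rw [hh, mul_inv_cancel])
          exact ⟨hfixed i₁ hi₁, hfixed i₂ hi₂⟩
      _ ≤ ENNReal.ofReal (∏ t, C t) * ∑ _k₁ : Fin (l i₁) × Fin 3 × Fin 3,
            ∑ _k₂ : Fin (l i₂) × Fin 3 × Fin 3, (‖c i₁‖ₑ ^ 2 + ‖c i₂‖ₑ ^ 2) := by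
          rw [ENNReal.tsum_mul_left]
          gcongr
          exact tsum_sum_mul_sum_le (hσ i₁ hi₁) (hσ i₂ hi₂)
      _ ≤ _ := by
          gcongr
          · exact hcn' i₁
          · exact hcn' i₂
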